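/- Let $\lambda>0$, $X\in\mathbb R^{n\times p}$, $Y\in\mathbb R^{n\times m}$, and let the entries of every row of $X$ and of every row of $Y$ be in decreasing order of magnitude. The proximal problem of the 1-path-norm at $(X,Y)$ is $$\min_{V\in\mathbb R^{n\times p},\,W\in\mathbb R^{n\times m}}\ \lambda\sum_{i,j,k}|W_{ij}V_{ik}|+\tfrac12\Big(\sum_{i,k}(V_{ik}-X_{ik})^2+\sum_{i,j}(W_{ij}-Y_{ij})^2\Big).$$ For one pair of rows $x\in\mathbb R^p$, $y\in\mathbb R^m$ put $$h_\lambda(v,w)=\tfrac12\sum_k(v_k-|x_k|)^2+\tfrac12\sum_j(w_j-|y_j|)^2+\lambda\sum_k v_k\sum_j w_j ,$$ and for $(s_v,s_w)\in\{0,\dots,p\}\times\{0,\dots,m\}$ let the candidate $(v^{(s_v,s_w)},w^{(s_v,s_w)})$ be given by $$v_k^{(s_v,s_w)}=|x_k|+\frac{\lambda^2 s_w\sum_{l\le s_v}|x_l|-\lambda\sum_{j\le s_w}|y_j|}{1-s_vs_w\lambda^2}\ (k\le s_v),\qquad w_j^{(s_v,s_w)}=|y_j|+\frac{\lambda^2 s_v\sum_{l\le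 s_w}|y_l|-\lambda\sum_{k\le s_v}|x_k|}{1-s_vs_w\lambda^2}\ (j\le s_w),$$ and $v_k^{(s_v,s_w)}=0$ for $k>s_v$, $w_j^{(s_v,s_w)}=0$ for $j>s_w$. The pair $(s_v,s_w)$ is feasible if $s_vs_w<\lambda^{-2}$, $v^{(s_v,s_w)}_{s_v}\ge0$ (no condition if $s_v=0$) and $w^{(s_v,s_w)}_{s_w}\ge0$ (no condition if $s_w=0$). The maximal feasibility boundary (MFB) is the set of feasible pairs $(s_v,s_w)$ for which neither $(s_v+1,s_w)$ nor $(s_v,s_w+1)$ is a feasible pair in $\{0,\dots,p\}\times\{0,\dots,m\}$. The boundary algorithm first computes the cumulative sums of $|x|$ and $|y|$. It starts with $(s_v,s_w)=(0,m)$, $S=\emptyset$ and a flag set to true. While $s_v\le p$ and $s_w\ge0$: if $(s_v,s_w)$ is feasible, it increments $s_v$ and sets the flag to true; otherwise, if the flag is true it adds $(s_v-1,s_w)$ to $S$ and sets the flag to false, and in either case it decrements $s_w$. At the end, if $s_v=p+1$, it adds $(p,s_w)$ to $S$. It returns $S$. The proximal algorithm calls the boundary algorithm, computes $(v^{(s_v,s_w)},w^{(s_v,s_w)})$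 and its value under $h_\lambda$ for every $(s_v,s_w)\in S$, keeps a pair $(v^*,w^*)$ with the smallest value, and returns $(\operatorname{sign}(x)\circ v^*,\operatorname{sign}(y)\circ w^*)$. Then the following hold. 1. If, for every $i$, the $i$-th rows of $V^*$ and $W^*$ are the output of the proximal algorithm on the $i$-th rows of $X$ and $Y$ and $\lambda$, then $(V^*,W^*)$ is a global minimizer of the proximal problem. 2. For each pair of rows, the set returned by the boundary algorithm is exactly the MFB, the proximal algorithm evaluates candidates exactly at the pairs in the MFB, and its output is $(\operatorname{sign}(x)\circ v^{(s_v,s_w)},\operatorname{sign}(y)\circ w^{(s_v,s_w)})$ for a pair $(s_v,s_w)$ that minimizes $h_\lambda(v^{(s_v,s_w)},w^{(s_v,s_w)})$ over the MFB. 3. On a real random access machine, where arithmetic operations, comparisons, array accesses and counter operations take one step each, for $m,p\ge1$ and for each pair of rows the boundary algorithm takes $O(m+p)$ steps and the proximal algorithm takes $O(\min(m,p)(m+p))$ steps in total, with absolute constants. -/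

import Mathlib

namespace PathNorm

/-! ## The proximal problem -/

/-- The 1-path-norm `∑ i j k, |W i j * V i k|`. -/
noncomputable def pathNorm {n p m : ℕ} (V : Matrix (Fin n) (Fin p) ℝ)
    (W : Matrix (Fin n) (Fin m) ℝ) : ℝ :=
  ∑ i, ∑ j, ∑ k, |W i j * V i k|

/-- The objective of the proximal problem of `lam * pathNorm` at the point `(X, Y)`. -/
noncomputable def proxObjective {n p m : ℕ} (lam : ℝ) (X : Matrix (Fin n) (Fin p) ℝ)
    (Y : Matrix (Fin n) (Fin m) ℝ)
    (U : Matrix (Fin n) (Fin p) ℝ × Matrix (Fin n) (Fin m) ℝ) : ℝ :=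
  lam * pathNorm U.1 U.2 +
    (1 / 2) * ((∑ i, ∑ k, (U.1 i k - X i k) ^ 2) + ∑ i, ∑ j, (U.2 i j - Y i j) ^ 2)

/-- The row objective `h_lam(v, w; x, y)`, which is minimized over nonnegative `v`, `w`. -/
noncomputable def rowObjective {p m : ℕ} (lam : ℝ) (x : Fin p → ℝ) (y : Fin m → ℝ)
    (v : Fin p → ℝ) (w : Fin m → ℝ) : ℝ :=
  (1 / 2) * (∑ k, (v k - |x k|) ^ 2) + (1 / 2) * (∑ j, (w j - |y j|) ^ 2) +
    lam * (∑ k, v k) * (∑ j, w j)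

/-! ## Candidates, feasible sparsity pairs, maximal feasibility boundary -/

/-- The sum of the magnitudes of the first `s` entries. -/
noncomputable def headSum {p : ℕ} (x : Fin p → ℝ) (s : ℕ) : ℝ :=
  ∑ k : Fin p with k.val < s, |x k|

/-- The closed-form candidate `v^(sv, sw)`; the entry `v_k` of the usual one-based
numbering is the value at the index `k - 1`. -/
noncomputable def candV {p m : ℕ} (lam : ℝ) (x : Fin p → ℝ) (y : Fin m → ℝ) (sv sw : ℕ) :
    Fin p → ℝ := fun k =>
  if k.val < sv then
    |x k| + 1 / (1 - sv * sw * lam ^ 2) *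
      (lam ^ 2 * sw * headSum x sv - lam * headSum y sw)
  else 0

/-- The closed-form candidate `w^(sv, sw)`. -/
noncomputable def candW {p m : ℕ} (lam : ℝ) (x : Fin p → ℝ) (y : Fin m → ℝ) (sv sw : ℕ) :
    Fin m → ℝ := fun j =>
  if j.val < sw then
    |y j| + 1 / (1 - sv * sw * lam ^ 2) *
      (lam ^ 2 * sv * headSum y sw - lam * headSum x sv)
  else 0

/-- A sparsity pair in `{0,…,p} × {0,…,m}` is feasible if the last nonzero-pattern entries
`v_{sv}` and `w_{sw}` of its candidate (where there are any) are nonnegative and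
`sv * sw < lam⁻²`. -/
def Feasible {p m : ℕ} (lam : ℝ) (x : Fin p → ℝ) (y : Fin m → ℝ) (sv sw : ℕ) : Prop :=
  sv ≤ p ∧ sw ≤ m ∧
    (∀ k : Fin p, k.val + 1 = sv → 0 ≤ candV lam x y sv sw k) ∧
    (∀ j : Fin m, j.val + 1 = sw → 0 ≤ candW lam x y sv sw j) ∧
    (sv : ℝ) * sw < (lam ^ 2)⁻¹

/-- The maximal feasibility boundary: the feasible pairs that become infeasible (or leave
`{0,…,p} × {0,…,m}`) when either component is incremented. -/
def MFB {p m : ℕ} (lam : ℝ) (x : Fin p → ℝ) (y : Fin m → ℝ) : Set (ℕ × ℕ) :=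
  {s | Feasible lam x y s.1 s.2 ∧ ¬ Feasible lam x y (s.1 + 1) s.2 ∧
    ¬ Feasible lam x y s.1 (s.2 + 1)}

/-! ## A real random access machine with a step count -/

inductive BinOp where
  | add
  | sub
  | mul
  | div

inductive UnOp where
  | abs
  | sign

/-- Programs of a real random access machine with real values in `R` and arrays of reals
in `A`. A program that is written for arbitrary types `R` and `A` can compute with reals,
compare them and access arrays through the instructions only. The instruction `tick` pays
for one operation on counters, flags or lists of pairs of counters. -/
inductive Prog (R A α : Type) : Type where
  | ret (a : α)
  | nat (n : ℕ) (k : R → Prog R A α)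
  | un (o : UnOp) (a : R) (k : R → Prog R A α)
  | bin (o : BinOp) (a b : R) (k : R → Prog R A α)
  | lt (a b : R) (k : Bool → Prog R A α)
  | alloc (n : ℕ) (k : A → Prog R A α)
  | read (a : A) (i : ℕ) (k : R → Prog R A α)
  | write (a : A) (i : ℕ) (r : R) (k : A → Prog R A α)
  | tick (k : Prog R A α)

namespace Prog

/-- Sequential composition. -/
def andThen {R A α β : Type} : Prog R A α → (α → Prog R A β) → Prog R A β
  | ret a, f => f a
  | nat n k, f => nat n fun r => (k r).andThen f
  | un o a k, f => un o a fun r => (k r).andThen f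
  | bin o a b k, f => bin o a b fun r => (k r).andThen f
  | lt a b k, f => lt a b fun r => (k r).andThen f
  | alloc n k, f => alloc n fun r => (k r).andThen f
  | read a i k, f => read a i fun r => (k r).andThen f
  | write a i r k, f => write a i r fun b => (k b).andThen f
  | tick k, f => tick (k.andThen f)

instance instMonad {R A : Type} : Monad (Prog R A) where
  pure := ret
  bind := andThen

end Prog

noncomputable def BinOp.eval : BinOp → ℝ → ℝ → ℝ
  | add, a, b => a + b
  | sub, a, b => a - b
  | mul, a, b => a * b
  | div, a, b => a / b

noncomputable def UnOp.eval : UnOp → ℝ → ℝ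
  | abs, a => |a|
  | sign, a => Real.sign a

namespace Prog

open Classical in
/-- The result of a program on real numbers, an array being a map from indices to reals. -/
noncomputable def run {α : Type} : Prog ℝ (ℕ → ℝ) α → α
  | ret a => a
  | nat n k => (k (n : ℝ)).run
  | un o a k => (k (o.eval a)).run
  | bin o a b k => (k (o.eval a b)).run
  | lt a b k => (k (decide (a < b))).run
  | alloc _ k => (k fun _ => 0).run
  | read a i k => (k (a i)).run
  | write a i r k => (k (Function.update a i r)).run
  | tick k => k.run

open Classical in
/-- The number of steps of a program on real numbers: every instruction takes one step,
except that the allocation of a zero-filled array of length `n` takes `n + 1` steps. -/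
noncomputable def steps {α : Type} : Prog ℝ (ℕ → ℝ) α → ℕ
  | ret _ => 0
  | nat n k => (k (n : ℝ)).steps + 1
  | un o a k => (k (o.eval a)).steps + 1
  | bin o a b k => (k (o.eval a b)).steps + 1
  | lt a b k => (k (decide (a < b))).steps + 1
  | alloc n k => (k fun _ => 0).steps + (n + 1)
  | read a i k => (k (a i)).steps + 1
  | write a i r k => (k (Function.update a i r)).steps + 1
  | tick k => k.steps + 1

end Prog

/-! ### Single instructions -/

section Instructions

variable {R A : Type}

def natR (n : ℕ) : Prog R A R := .nat n .ret
def absR (a : R) : Prog R A R := .un .abs a .ret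
def signR (a : R) : Prog R A R := .un .sign a .ret
def addR (a b : R) : Prog R A R := .bin .add a b .ret
def subR (a b : R) : Prog R A R := .bin .sub a b .ret
def mulR (a b : R) : Prog R A R := .bin .mul a b .ret
def divR (a b : R) : Prog R A R := .bin .div a b .ret
def ltR (a b : R) : Prog R A Bool := .lt a b .ret
def newArr (n : ℕ) : Prog R A A := .alloc n .ret
def readA (a : A) (i : ℕ) : Prog R A R := .read a i .ret
def writeA (a : A) (i : ℕ) (r : R) : Prog R A A := .write a i r .ret
def tick : Prog R A Unit := .tick (.ret ())

/-- `for k = 0, …, n - 1 do s ← body k s`, with one extra step for each iteration. -/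
def forLoop {σ : Type} : ℕ → σ → (ℕ → σ → Prog R A σ) → Prog R A σ
  | 0, s, _ => pure s
  | n + 1, s, body => do
      let s' ← forLoop n s body
      tick
      body n s'

/-- `for c ∈ S do s ← body c s`, with one extra step for each iteration. -/
def forList {σ : Type} : List (ℕ × ℕ) → σ → (ℕ × ℕ → σ → Prog R A σ) → Prog R A σ
  | [], s, _ => pure s
  | c :: S, s, body => do
      tick
      let s' ← body c s
      forList S s' body

end Instructions

/-! ### Computing the maximal feasibility boundary -/

section Boundary

variable {R A : Type}

/-- The array of cumulative sums `P[s] = ∑ k < s, |x[k]|`, `s = 0, …, n`. -/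
def cumSums (x : A) (n : ℕ) : Prog R A A := do
  let P ← newArr (n + 1)
  forLoop n P fun k P => do
    let a ← readA x k
    let b ← absR a
    let c ← readA P k
    let d ← addR c b
    writeA P (k + 1) d

/-- `1 / (1 - s t lam²) * (lam² t a - lam b)`, the number that is added to the magnitudes. -/
def shift (lam : R) (s t : ℕ) (a b : R) : Prog R A R := do
  let one ← natR 1
  let sR ← natR s
  let tR ← natR t
  let lam2 ← mulR lam lam
  let st ← mulR sR tR
  let q ← mulR st lam2
  let d ← subR one q
  let mu ← divR one d
  let c ← mulR lam2 tR
  let e ← mulR c a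
  let f ← mulR lam b
  let g ← subR e f
  mulR mu g

/-- Is the `s`-th (one-based) entry `|x_s| + shift` negative? No if `s = 0`. -/
def lastNegative (x : A) (lam : R) (s t : ℕ) (a b : R) : Prog R A Bool := do
  tick
  match s with
  | 0 => pure false
  | s + 1 => do
      let c ← shift lam (s + 1) t a b
      let xs ← readA x s
      let ax ← absR xs
      let r ← addR ax c
      let zero ← natR 0
      ltR r zero

/-- The test `s t < lam⁻²`. -/
def productSmall (lam : R) (s t : ℕ) : Prog R A Bool := do
  let one ← natR 1
  let lam2 ← mulR lam lam
  let bd ← divR one lam2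
  let sR ← natR s
  let tR ← natR t
  let st ← mulR sR tR
  ltR st bd

/-- The feasibility test for `(sv, sw)`, given the cumulative sums `PX` and `PY`. The
product is tested first, so that there is no division by zero. -/
def feasibleTest (lam : R) (x y PX PY : A) (sv sw : ℕ) : Prog R A Bool := do
  let small ← productSmall lam sv sw
  if small then do
    let a ← readA PX sv
    let b ← readA PY sw
    let negV ← lastNegative x lam sv sw a b
    let negW ← lastNegative y lam sw sv b a
    tick
    pure (!negV && !negW)
  else pure false

/-- The while loop `while sv ≤ p and sw ≥ 0`, followed by the last test `sv = p + 1`. The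
second counter holds `sw + 1`, so that it is `0` exactly if `sw < 0`. -/
def boundaryLoop (p : ℕ) (lam : R) (x y PX PY : A) (sv : ℕ) (sw1 : ℕ) (maximal : Bool)
    (S : List (ℕ × ℕ)) : Prog R A (List (ℕ × ℕ)) :=
  match sw1 with
  | 0 => do
      tick
      pure S
  | sw + 1 =>
      if _hp : p < sv then do
        tick
        tick
        pure ((sv - 1, sw) :: S)
      else do
        tick
        let ok ← feasibleTest lam x y PX PY sv sw
        if ok then do
          tick
          tick
          boundaryLoop p lam x y PX PY (sv + 1) (sw + 1) true S
        else do
          tick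
          tick
          tick
          boundaryLoop p lam x y PX PY sv sw false
            (if maximal then (sv - 1, sw) :: S else S)
  termination_by (p + 1 - sv) + sw1

/-- The boundary algorithm: it walks from `(0, m)`, incrementing `sv` at feasible pairs and
decrementing `sw` at infeasible ones. -/
def boundaryAlg (p m : ℕ) (lam : R) (x y : A) : Prog R A (List (ℕ × ℕ)) := do
  let PX ← cumSums x p
  let PY ← cumSums y m
  boundaryLoop p lam x y PX PY 0 (m + 1) true []

end Boundary

/-! ### The multi-output proximal mapping of one row -/

section ProxAlg

variable {R A : Type}

/-- `∑ k < n, |x[k]|`. -/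
def absSum (x : A) (n : ℕ) : Prog R A R := do
  let zero ← natR 0
  forLoop n zero fun k acc => do
    let a ← readA x k
    let b ← absR a
    addR acc b

/-- `∑ k < n, v[k]`. -/
def arrSum (v : A) (n : ℕ) : Prog R A R := do
  let zero ← natR 0
  forLoop n zero fun k acc => do
    let a ← readA v k
    addR acc a

/-- `∑ k < n, (v[k] - |x[k]|)²`. -/
def sqDist (v x : A) (n : ℕ) : Prog R A R := do
  let zero ← natR 0
  forLoop n zero fun k acc => do
    let a ← readA v k
    let b ← readA x k
    let c ← absR b
    let d ← subR a c
    let e ← mulR d d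
    addR acc e

/-- The array of length `n` with entries `|x[k]| + c` for `k < s` and `0` otherwise. -/
def fillArr (x : A) (n s : ℕ) (c : R) : Prog R A A := do
  let v ← newArr n
  forLoop s v fun k v => do
    let a ← readA x k
    let b ← absR a
    let d ← addR b c
    writeA v k d

/-- The candidate `(v^(sv, sw), w^(sv, sw))`. -/
def candidate (p m : ℕ) (lam : R) (x y : A) (sv sw : ℕ) : Prog R A (A × A) := do
  let a ← absSum x sv
  let b ← absSum y sw
  let c ← shift lam sv sw a b
  let d ← shift lam sw sv b a
  let v ← fillArr x p sv c
  let w ← fillArr y m sw d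
  pure (v, w)

/-- The value of the row objective. -/
def evalObjective (p m : ℕ) (lam : R) (x y v w : A) : Prog R A R := do
  let a ← sqDist v x p
  let b ← sqDist w y m
  let c ← arrSum v p
  let d ← arrSum w m
  let e ← addR a b
  let two ← natR 2
  let f ← divR e two
  let g ← mulR lam c
  let h ← mulR g d
  addR f h

/-- The array of length `n` with entries `sign(x[k]) * v[k]`. -/
def applySign (x v : A) (n : ℕ) : Prog R A A := do
  let u ← newArr n
  forLoop n u fun k u => do
    let a ← readA x k
    let s ← signR a
    let b ← readA v k
    let c ← mulR s b
    writeA u k c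

/-- The variables of the main loop: the best value so far (`none` stands for `∞`), the point
where it is attained, and the list of the pairs that have been evaluated. -/
structure LoopState (R A : Type) where
  best : Option R
  v : A
  w : A
  evaluated : List (ℕ × ℕ)

/-- The output: the two vectors and the list of the pairs whose candidates were evaluated. -/
structure Output (A : Type) where
  v : A
  w : A
  evaluated : List (ℕ × ℕ)

/-- The body of the main loop. -/
def loopBody (p m : ℕ) (lam : R) (x y : A) (s : ℕ × ℕ) (st : LoopState R A) :
    Prog R A (LoopState R A) := do
  let c ← candidate p m lam x y s.1 s.2
  let h ← evalObjective p m lam x y c.1 c.2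
  tick
  tick
  let better ← (match st.best with
    | none => pure true
    | some b => ltR h b)
  if better then do
    tick
    tick
    tick
    pure ⟨some h, c.1, c.2, s :: st.evaluated⟩
  else pure ⟨st.best, st.v, st.w, s :: st.evaluated⟩

/-- The proximal algorithm for one row `x ∈ ℝ^p`, `y ∈ ℝ^m`. -/
def proxAlg (p m : ℕ) (lam : R) (x y : A) : Prog R A (Output A) := do
  let S ← boundaryAlg p m lam x y
  let v0 ← newArr p
  let w0 ← newArr m
  let st ← forList S ⟨none, v0, w0, []⟩ fun s st => loopBody p m lam x y s st
  let v ← applySign x st.v p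
  let w ← applySign y st.w m
  pure ⟨v, w, st.evaluated⟩

end ProxAlg

/-! ### Running the algorithms on real vectors and matrices -/

/-- The array that holds a vector, from index `0` on. -/
noncomputable def toArr {p : ℕ} (x : Fin p → ℝ) : ℕ → ℝ :=
  fun i => if h : i < p then x ⟨i, h⟩ else 0

/-- The vector that is held by an array. -/
def ofArr (p : ℕ) (a : ℕ → ℝ) : Fin p → ℝ := fun i => a i.val

/-- The boundary algorithm on the input `x`, `y`, `lam`. -/
noncomputable def boundaryProg {p m : ℕ} (lam : ℝ) (x : Fin p → ℝ) (y : Fin m → ℝ) :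
    Prog ℝ (ℕ → ℝ) (List (ℕ × ℕ)) :=
  boundaryAlg p m lam (toArr x) (toArr y)

/-- The proximal algorithm on the input `x`, `y`, `lam`. -/
noncomputable def proxProg {p m : ℕ} (lam : ℝ) (x : Fin p → ℝ) (y : Fin m → ℝ) :
    Prog ℝ (ℕ → ℝ) (Output (ℕ → ℝ)) :=
  proxAlg p m lam (toArr x) (toArr y)

/-- The matrices whose `i`-th rows are the output of the proximal algorithm on the `i`-th
rows of `X` and `Y`. -/
noncomputable def proxOutput {n p m : ℕ} (lam : ℝ) (X : Matrix (Fin n) (Fin p) ℝ)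
    (Y : Matrix (Fin n) (Fin m) ℝ) :
    Matrix (Fin n) (Fin p) ℝ × Matrix (Fin n) (Fin m) ℝ :=
  (Matrix.of fun i => ofArr p (proxProg lam (X i) (Y i)).run.v,
   Matrix.of fun i => ofArr m (proxProg lam (X i) (Y i)).run.w)

end PathNorm

/-!
For one pair of rows, restoring the signs reduces the proximal problem to minimizing
`h(v, w) = rowObjective lam x y v w` over nonnegative `v`, `w`. This function is not convex, but it
is convex in `v` and in `w` separately, so a minimizer satisfies `v k = max 0 (|x k| - lam * ∑ w)`
and `w j = max 0 (|y j| - lam * ∑ v)`. As the magnitudes decrease, its supports are the first `s`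
and the first `t` indices. If `s * t * lam² ≥ 1`, there is a direction on these supports along which
`h` does not increase and `∑ v` decreases; hence a minimizer with the least `∑ v` has
`s * t * lam² < 1`, and then the stationarity equations identify it with the candidate of the
feasible pair `(s, t)` (`exists_minimizer`, `exists_feasible_minimizer`).

For `s * t * lam² < 1` the function `h` is convex on the vectors with these supports, by the
Cauchy-Schwarz inequality, and the candidate is its minimizer there (`rowObjective_cand_le`). So the
value of the candidate decreases whenever a feasible pair is enlarged to another one, and a best
candidate can be found on the maximal feasibility boundary (`Feasible.exists_mem_MFB_le`).

The feasible pairs form a lower set of the grid (`Feasible.pred_left`, `Feasible.mono`). The walk of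
the boundary algorithm therefore follows the staircase that bounds this set, and it records exactly
the maximal elements (`mem_run_boundaryLoop`). It moves at most `m + p + 2` times, and it records at
most `min m p + 2` pairs (`length_run_boundaryLoop_le`), each of which costs `O(m + p)` steps in the
proximal algorithm.
-/

namespace PathNorm

/-! ### Sums over initial segments -/

section HeadSum

variable {p : ℕ}

theorem headSum_eq_sum_range (x : Fin p → ℝ) (s : ℕ) :
    headSum x s = ∑ k ∈ Finset.range s, |toArr x k| := by
  induction s with
  | zero => simp [headSum]
  | succ s ih =>
    rw [Finset.sum_range_succ, ← ih]
    unfold headSum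
    by_cases hs : s < p
    · have h : (Finset.univ.filter fun k : Fin p => k.val < s + 1) =
          insert ⟨s, hs⟩ (Finset.univ.filter fun k : Fin p => k.val < s) := by
        ext k
        simp [Fin.ext_iff]
        omega
      rw [h, Finset.sum_insert (by simp), add_comm]
      simp [toArr, hs]
    · have h : (Finset.univ.filter fun k : Fin p => k.val < s + 1) =
          Finset.univ.filter fun k : Fin p => k.val < s := by
        ext k
        have := k.isLt
        simp
        omega
      rw [h]
      simp [toArr, hs]

theorem headSum_succ (x : Fin p → ℝ) {s : ℕ} (hs : s < p) :
    headSum x (s + 1) = headSum x s + |x ⟨s, hs⟩| := by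
  simp [headSum_eq_sum_range, Finset.sum_range_succ, toArr, hs]

theorem sum_ite_lt_const {s : ℕ} (hs : s ≤ p) (c : ℝ) :
    ∑ k : Fin p, (if k.val < s then c else 0) = s * c := by
  rw [Fin.sum_univ_eq_sum_range (fun k => if k < s then c else 0) p, ← Finset.sum_filter]
  have h : (Finset.range p).filter (fun k => k < s) = Finset.range s := by
    ext k
    simp
    omega
  rw [h]
  simp

theorem sum_ite_lt_abs_add (x : Fin p → ℝ) {s : ℕ} (hs : s ≤ p) (c : ℝ) :
    ∑ k : Fin p, (if k.val < s then |x k| + c else 0) = headSum x s + s * c := by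
  rw [← sum_ite_lt_const hs c, headSum, Finset.sum_filter, ← Finset.sum_add_distrib]
  refine Finset.sum_congr rfl fun k _ => ?_
  split_ifs <;> simp

end HeadSum

/-! ### Candidates -/

section Candidates

variable {p m : ℕ} {lam : ℝ} {x : Fin p → ℝ} {y : Fin m → ℝ} {s t : ℕ}

/-- The common amount that is added to the `s` leading magnitudes in a candidate, where `a` and
`b` are the sums of the leading magnitudes of the vector itself and of the other vector. -/
noncomputable def offset (lam : ℝ) (s t : ℕ) (a b : ℝ) : ℝ :=
  1 / (1 - s * t * lam ^ 2) * (lam ^ 2 * t * a - lam * b)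

theorem candV_apply (k : Fin p) : candV lam x y s t k =
    if k.val < s then |x k| + offset lam s t (headSum x s) (headSum y t) else 0 := rfl

/-- The two halves of a candidate are exchanged when the two vectors are. -/
theorem candW_eq_candV : candW lam x y s t = candV lam y x t s := by
  funext j
  simp only [candW, candV, mul_comm (s : ℝ) (t : ℝ)]

theorem candW_apply (j : Fin m) : candW lam x y s t j =
    if j.val < t then |y j| + offset lam t s (headSum y t) (headSum x s) else 0 := by
  rw [candW_eq_candV, candV_apply]

theorem sum_candV (hs : s ≤ p) : ∑ k, candV lam x y s t k =
    headSum x s + s * offset lam s t (headSum x s) (headSum y t) :=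
  sum_ite_lt_abs_add x hs _

theorem sum_candW (ht : t ≤ m) : ∑ j, candW lam x y s t j =
    headSum y t + t * offset lam t s (headSum y t) (headSum x s) := by
  rw [candW_eq_candV, sum_candV ht]

/-- Stationarity of the row objective in the coordinates of the support. -/
theorem offset_eq (lam : ℝ) (s t : ℕ) (a b : ℝ) (h : (s : ℝ) * t * lam ^ 2 < 1) :
    offset lam s t a b = -lam * (b + t * offset lam t s b a) := by
  have h1 : 1 - (s : ℝ) * t * lam ^ 2 ≠ 0 := by linarith
  unfold offset
  rw [mul_comm (t : ℝ) (s : ℝ)]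
  field_simp
  ring

end Candidates

/-! ### Feasible pairs form a lower set -/

section Feasible

variable {p m : ℕ} {lam : ℝ} {x : Fin p → ℝ} {y : Fin m → ℝ} {s t s' t' : ℕ}

theorem feasible_comm : Feasible lam x y s t ↔ Feasible lam y x t s := by
  unfold Feasible
  simp only [candW_eq_candV, mul_comm (s : ℝ) (t : ℝ)]
  tauto

theorem mul_lt_inv_sq_iff (hlam : 0 < lam) (s t : ℕ) :
    (s : ℝ) * t < (lam ^ 2)⁻¹ ↔ (s : ℝ) * t * lam ^ 2 < 1 := by
  rw [← one_div, lt_div_iff₀ (by positivity)]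

theorem Feasible.mul_lt_one (hlam : 0 < lam) (h : Feasible lam x y s t) :
    (s : ℝ) * t * lam ^ 2 < 1 :=
  (mul_lt_inv_sq_iff hlam s t).1 h.2.2.2.2

theorem feasible_zero_left (hlam : 0 < lam) (ht : t ≤ m) : Feasible lam x y 0 t := by
  refine ⟨Nat.zero_le _, ht, by simp, fun j hj => ?_, by simpa using by positivity⟩
  rw [candW_apply, if_pos (by omega)]
  simp [offset, headSum]

theorem nonneg_add_offset_iff (h : (s : ℝ) * t * lam ^ 2 < 1) (a b c : ℝ) :
    0 ≤ a + offset lam s t b c ↔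
      0 ≤ a * (1 - s * t * lam ^ 2) + (lam ^ 2 * t * b - lam * c) := by
  have h1 : 0 < 1 - (s : ℝ) * t * lam ^ 2 := by linarith
  have h2 : a + offset lam s t b c =
      (a * (1 - s * t * lam ^ 2) + (lam ^ 2 * t * b - lam * c)) / (1 - s * t * lam ^ 2) := by
    unfold offset
    field_simp
  rw [h2, le_div_iff₀ h1, zero_mul]

theorem Feasible.pred_left (hlam : 0 < lam) (hx : Antitone fun k => |x k|)
    (h : Feasible lam x y (s + 1) t) : Feasible lam x y s t := by
  have hd := h.mul_lt_one hlam
  obtain ⟨hs, ht, hv, hw, -⟩ := h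
  have hd' : (s : ℝ) * t * lam ^ 2 < 1 := by
    refine lt_of_le_of_lt ?_ hd
    gcongr
    simp
  have hsp : s < p := hs
  have hV := hv ⟨s, hsp⟩ rfl
  rw [candV_apply, if_pos (by simp), nonneg_add_offset_iff hd, headSum_succ x hsp] at hV
  refine ⟨by omega, ht, fun k hk => ?_, fun j hj => ?_, (mul_lt_inv_sq_iff hlam s t).2 hd'⟩
  · rw [candV_apply, if_pos (by omega), nonneg_add_offset_iff hd']
    have hle : |x ⟨s, hsp⟩| ≤ |x k| := hx (show k ≤ ⟨s, hsp⟩ from by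
      rw [Fin.le_def]; simp; omega)
    have h1 : 0 ≤ (|x k| - |x ⟨s, hsp⟩|) * (1 - s * t * lam ^ 2) :=
      mul_nonneg (by linarith) (by linarith)
    push_cast at hV
    linarith
  · have hW := hw j hj
    rw [mul_comm] at hd'
    rw [candW_apply, if_pos (by omega), nonneg_add_offset_iff (by linarith)]
    rw [candW_apply, if_pos (by omega), nonneg_add_offset_iff (by linarith),
      headSum_succ x hsp] at hW
    push_cast at hV hW hd
    -- with `d = 1 - (s + 1) t lam²`, the two conditions at `(s + 1, t)` combine to `0 ≤ d * z`,
    -- and the condition at `(s, t)` is one of them plus `lam * z`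
    have hz : 0 ≤ |x ⟨s, hsp⟩| + lam * t * |y j| - lam * headSum y t := by
      refine nonneg_of_mul_nonneg_right (b := _) (a := 1 - ((s : ℝ) + 1) * t * lam ^ 2)
        ?_ (by linarith)
      have h2 : 0 ≤ lam * t * (|y j| * (1 - t * (s + 1) * lam ^ 2) +
          (lam ^ 2 * (s + 1) * headSum y t - lam * (headSum x s + |x ⟨s, hsp⟩|))) :=
        mul_nonneg (by positivity) hW
      linarith
    have h3 := mul_nonneg hlam.le hz
    linarith

theorem Feasible.mono (hlam : 0 < lam) (hx : Antitone fun k => |x k|)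
    (hy : Antitone fun j => |y j|) (h : Feasible lam x y s t) (hs : s' ≤ s) (ht : t' ≤ t) :
    Feasible lam x y s' t' := by
  have h1 : Feasible lam x y s' t :=
    Nat.decreasingInduction' (P := fun a => Feasible lam x y a t)
      (fun _ _ _ ih => ih.pred_left hlam hx) hs h
  exact Nat.decreasingInduction' (P := fun b => Feasible lam x y s' b)
    (fun _ _ _ ih => feasible_comm.2 ((feasible_comm.1 ih).pred_left hlam hy)) ht h1

theorem Feasible.candV_nonneg (hx : Antitone fun k => |x k|)
    (h : Feasible lam x y s t) (k : Fin p) : 0 ≤ candV lam x y s t k := by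
  rw [candV_apply]
  split_ifs with hk
  · have hs := h.1
    have h1 := h.2.2.1 ⟨s - 1, by omega⟩ (by simp; omega)
    rw [candV_apply, if_pos (by simp; omega)] at h1
    have hle : |x ⟨s - 1, by omega⟩| ≤ |x k| := hx (show k ≤ ⟨s - 1, by omega⟩ from by
      rw [Fin.le_def]; simp; omega)
    linarith
  · exact le_rfl

theorem Feasible.candW_nonneg (hy : Antitone fun j => |y j|)
    (h : Feasible lam x y s t) (j : Fin m) : 0 ≤ candW lam x y s t j := by
  rw [candW_eq_candV]
  exact (feasible_comm.1 h).candV_nonneg hy j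

end Feasible

/-! ### Optimality of candidates on their supports -/

section Objective

variable {p m : ℕ} {lam : ℝ} {x : Fin p → ℝ} {y : Fin m → ℝ} {s t : ℕ}

theorem sq_sum_le_of_support {s : ℕ} (hs : s ≤ p) (d : Fin p → ℝ)
    (hd : ∀ k : Fin p, s ≤ k.val → d k = 0) : (∑ k, d k) ^ 2 ≤ s * ∑ k, d k ^ 2 := by
  have h1 : ∑ k, d k = ∑ k with k.val < s, d k := by
    rw [Finset.sum_filter]
    refine Finset.sum_congr rfl fun k _ => ?_
    split_ifs with h
    · rfl
    · exact hd k (by omega)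
  have h2 : ((Finset.univ.filter fun k : Fin p => k.val < s).card : ℝ) = s := by
    have := sum_ite_lt_const hs 1
    rw [← Finset.sum_filter] at this
    simpa using this
  rw [h1, ← h2]
  refine sq_sum_le_card_mul_sum_sq.trans ?_
  gcongr
  exact Finset.filter_subset _ _

/-- The second-order expansion of the row objective at `(v, w)` in the direction `(d, e)`. -/
theorem rowObjective_add (v d : Fin p → ℝ) (w e : Fin m → ℝ) :
    rowObjective lam x y (fun k => v k + d k) (fun j => w j + e j) =
      rowObjective lam x y v w +
      ∑ k, (v k - |x k| + lam * ∑ j, w j) * d k + ∑ j, (w j - |y j| + lam * ∑ k, v k) * e j +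
      ((∑ k, d k ^ 2) / 2 + (∑ j, e j ^ 2) / 2 + lam * (∑ k, d k) * ∑ j, e j) := by
  have h (n : ℕ) (a b z : Fin n → ℝ) (c : ℝ) : ∑ k, (a k + b k - |z k|) ^ 2 =
      ∑ k, (a k - |z k|) ^ 2 + 2 * ∑ k, (a k - |z k| + c) * b k + ∑ k, b k ^ 2
        - 2 * c * ∑ k, b k := by
    simp only [Finset.mul_sum, ← Finset.sum_add_distrib, ← Finset.sum_sub_distrib]
    exact Finset.sum_congr rfl fun k _ => by ring
  unfold rowObjective
  rw [h p v d x (lam * ∑ j, w j), h m w e y (lam * ∑ k, v k), Finset.sum_add_distrib,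
    Finset.sum_add_distrib]
  ring

/-- For `s * t * lam² < 1` the row objective is convex on the vectors with supports in the first
`s` and `t` indices, and the candidate is its minimizer there. -/
theorem rowObjective_cand_le (hlam : 0 < lam) (hs : s ≤ p) (ht : t ≤ m)
    (h : (s : ℝ) * t * lam ^ 2 < 1) (v : Fin p → ℝ) (w : Fin m → ℝ)
    (hv : ∀ k : Fin p, s ≤ k.val → v k = 0) (hw : ∀ j : Fin m, t ≤ j.val → w j = 0) :
    rowObjective lam x y (candV lam x y s t) (candW lam x y s t) ≤ rowObjective lam x y v w := by
  set v₀ := candV lam x y s t with hv₀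
  set w₀ := candW lam x y s t with hw₀
  obtain ⟨d, rfl⟩ : ∃ d : Fin p → ℝ, v = fun k => v₀ k + d k :=
    ⟨fun k => v k - v₀ k, by funext k; ring⟩
  obtain ⟨e, rfl⟩ : ∃ e : Fin m → ℝ, w = fun j => w₀ j + e j :=
    ⟨fun j => w j - w₀ j, by funext j; ring⟩
  have hd (k : Fin p) (hk : s ≤ k.val) : d k = 0 := by
    have := hv k hk
    simpa [hv₀, candV_apply, not_lt.2 hk] using this
  have he (j : Fin m) (hj : t ≤ j.val) : e j = 0 := by
    have := hw j hj
    simpa [hw₀, candW_apply, not_lt.2 hj] using this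
  have hgv : ∑ k, (v₀ k - |x k| + lam * ∑ j, w₀ j) * d k = 0 := by
    refine Finset.sum_eq_zero fun k _ => ?_
    by_cases hk : k.val < s
    · rw [hw₀, sum_candW ht, hv₀, candV_apply, if_pos hk, offset_eq lam s t _ _ h]
      ring
    · rw [hd k (by omega), mul_zero]
  have hgw : ∑ j, (w₀ j - |y j| + lam * ∑ k, v₀ k) * e j = 0 := by
    refine Finset.sum_eq_zero fun j _ => ?_
    by_cases hj : j.val < t
    · rw [hv₀, sum_candV hs, hw₀, candW_apply, if_pos hj,
        offset_eq lam t s _ _ (by linarith [mul_comm (s : ℝ) t])]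
      ring
    · rw [he j (by omega), mul_zero]
  rw [rowObjective_add, hgv, hgw]
  have hA := sq_sum_le_of_support hs d hd
  have hB := sq_sum_le_of_support ht e he
  set P := ∑ k, d k ^ 2
  set Q := ∑ j, e j ^ 2
  set A := ∑ k, d k
  set B := ∑ j, e j
  have hP : 0 ≤ P := Finset.sum_nonneg fun k _ => sq_nonneg _
  have hQ : 0 ≤ Q := Finset.sum_nonneg fun j _ => sq_nonneg _
  have h1 : (lam * A * B) ^ 2 ≤ ((P + Q) / 2) ^ 2 :=
    calc (lam * A * B) ^ 2 = lam ^ 2 * (A ^ 2 * B ^ 2) := by ring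
      _ ≤ lam ^ 2 * ((s * P) * (t * Q)) := by gcongr
      _ = (s * t * lam ^ 2) * (P * Q) := by ring
      _ ≤ 1 * (P * Q) := by gcongr
      _ ≤ ((P + Q) / 2) ^ 2 := by nlinarith [sq_nonneg (P - Q)]
  have h2 := (abs_le_of_sq_le_sq' h1 (by positivity)).1
  linarith

/-- The value of the candidates decreases towards the maximal feasibility boundary. -/
theorem Feasible.exists_mem_MFB_le (hlam : 0 < lam) (h : Feasible lam x y s t) :
    ∃ r ∈ MFB lam x y,
      rowObjective lam x y (candV lam x y r.1 r.2) (candW lam x y r.1 r.2) ≤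
        rowObjective lam x y (candV lam x y s t) (candW lam x y s t) := by
  induction hn : p + m - (s + t) using Nat.strong_induction_on generalizing s t with
  | _ n ih =>
    -- a step to a larger feasible pair enlarges the supports over which candidates are optimal
    have step (s' t' : ℕ) (h' : Feasible lam x y s' t') (hs : s ≤ s') (ht : t ≤ t')
        (hlt : s + t < s' + t') : ∃ r ∈ MFB lam x y,
        rowObjective lam x y (candV lam x y r.1 r.2) (candW lam x y r.1 r.2) ≤
          rowObjective lam x y (candV lam x y s t) (candW lam x y s t) := by
      obtain ⟨r, hr, hle⟩ := ih (p + m - (s' + t'))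
        (by have := h'.1; have := h'.2.1; omega) h' rfl
      refine ⟨r, hr, hle.trans ?_⟩
      refine rowObjective_cand_le hlam h'.1 h'.2.1 (h'.mul_lt_one hlam) _ _
        (fun k hk => ?_) (fun j hj => ?_)
      · rw [candV_apply, if_neg (by omega)]
      · rw [candW_apply, if_neg (by omega)]
    by_cases h1 : Feasible lam x y (s + 1) t
    · exact step _ _ h1 (by omega) le_rfl (by omega)
    by_cases h2 : Feasible lam x y s (t + 1)
    · exact step _ _ h2 le_rfl (by omega) (by omega)
    · exact ⟨(s, t), ⟨h, h1, h2⟩, le_rfl⟩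

end Objective

/-! ### Global minimizers of the row objective -/

section Minimizer

variable {p m : ℕ} {lam : ℝ} {x : Fin p → ℝ} {y : Fin m → ℝ}

theorem rowObjective_comm (v : Fin p → ℝ) (w : Fin m → ℝ) :
    rowObjective lam x y v w = rowObjective lam y x w v := by
  unfold rowObjective
  ring

theorem objective_mono (hlam : 0 ≤ lam) {a a' b b' c c' d d' : ℝ} (ha : a ≤ a') (hb : b ≤ b')
    (hc : c ≤ c') (hd : d ≤ d') (hc' : 0 ≤ c') (hd' : 0 ≤ d) :
    (1 / 2) * a + (1 / 2) * b + lam * c * d ≤ (1 / 2) * a' + (1 / 2) * b' + lam * c' * d' := by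
  gcongr

theorem rowObjective_inf_le (hlam : 0 < lam) {v : Fin p → ℝ} {w : Fin m → ℝ}
    (hv : 0 ≤ v) (hw : 0 ≤ w) :
    rowObjective lam x y (v ⊓ fun k => |x k|) (w ⊓ fun j => |y j|) ≤
      rowObjective lam x y v w := by
  have hsq (a b : ℝ) : (a ⊓ |b| - |b|) ^ 2 ≤ (a - |b|) ^ 2 := by
    rcases le_total a |b| with h | h
    · rw [inf_eq_left.2 h]
    · rw [inf_eq_right.2 h]
      simp [sq_nonneg]
  have h1 : 0 ≤ ∑ j, (w ⊓ fun j => |y j|) j :=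
    Finset.sum_nonneg fun j _ => le_inf (hw j) (abs_nonneg _)
  have h2 : 0 ≤ ∑ k, v k := Finset.sum_nonneg fun k _ => hv k
  exact objective_mono hlam.le (Finset.sum_le_sum fun k _ => hsq _ _)
    (Finset.sum_le_sum fun j _ => hsq _ _) (Finset.sum_le_sum fun k _ => inf_le_left)
    (Finset.sum_le_sum fun j _ => inf_le_left) h2 h1

/-- Among the minimizers of the row objective over the nonnegative vectors there is one with the
least `∑ k, v k`. This choice excludes the degenerate minimizers at which the objective is
constant in some direction. -/
theorem exists_minimizer (hlam : 0 < lam) (x : Fin p → ℝ) (y : Fin m → ℝ) :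
    ∃ v w, 0 ≤ v ∧ 0 ≤ w ∧
      (∀ v' w', 0 ≤ v' → 0 ≤ w' → rowObjective lam x y v w ≤ rowObjective lam x y v' w') ∧
      ∀ v' w', 0 ≤ v' → 0 ≤ w' → rowObjective lam x y v' w' ≤ rowObjective lam x y v w →
        ∑ k, v k ≤ ∑ k, v' k := by
  set K : Set ((Fin p → ℝ) × (Fin m → ℝ)) :=
    Set.Icc 0 (fun k => |x k|) ×ˢ Set.Icc 0 (fun j => |y j|)
  have hK : IsCompact K := isCompact_Icc.prod isCompact_Icc
  have hclamp (v : Fin p → ℝ) (w : Fin m → ℝ) (hv : 0 ≤ v) (hw : 0 ≤ w) :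
      (v ⊓ fun k => |x k|, w ⊓ fun j => |y j|) ∈ K :=
    ⟨⟨le_inf hv fun _ => abs_nonneg _, inf_le_right⟩,
      ⟨le_inf hw fun _ => abs_nonneg _, inf_le_right⟩⟩
  set f : (Fin p → ℝ) × (Fin m → ℝ) → ℝ := fun q => rowObjective lam x y q.1 q.2
  have hfc : Continuous f := by
    unfold f rowObjective
    fun_prop
  obtain ⟨q₀, hq₀, hmin⟩ := hK.exists_isMinOn ⟨_, hclamp 0 0 le_rfl le_rfl⟩ hfc.continuousOn
  have hK' : IsCompact (K ∩ {q | f q ≤ f q₀}) :=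
    hK.inter_right (isClosed_le hfc continuous_const)
  obtain ⟨q, hq, hsum⟩ := hK'.exists_isMinOn (f := fun q => ∑ k, q.1 k) ⟨q₀, hq₀, le_refl (f q₀)⟩
    (by fun_prop)
  refine ⟨q.1, q.2, hq.1.1.1, hq.1.2.1, fun v w hv hw => ?_, fun v w hv hw hle => ?_⟩
  · exact (hq.2.trans (hmin (hclamp v w hv hw))).trans (rowObjective_inf_le hlam hv hw)
  · refine (hsum ⟨hclamp v w hv hw, ?_⟩).trans (Finset.sum_le_sum fun k _ => inf_le_left)
    exact ((rowObjective_inf_le hlam hv hw).trans hle).trans hq.2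

theorem eq_max_of_minimizer {v : Fin p → ℝ} {w : Fin m → ℝ} (hv : 0 ≤ v)
    (hmin : ∀ v', 0 ≤ v' → rowObjective lam x y v w ≤ rowObjective lam x y v' w) (k : Fin p) :
    v k = max 0 (|x k| - lam * ∑ j, w j) := by
  set c := lam * ∑ j, w j with hc
  set v' : Fin p → ℝ := fun k => max 0 (|x k| - c) with hv'
  have h1 := rowObjective_add (lam := lam) (x := x) (y := y) v' (fun k => v k - v' k) w 0
  have h2 : (fun k => v' k + (v k - v' k)) = v := by funext k; ring
  have h3 : (fun j => w j + (0 : Fin m → ℝ) j) = w := by funext j; simp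
  have h4 : 0 ≤ ∑ k, (v' k - |x k| + c) * (v k - v' k) := by
    refine Finset.sum_nonneg fun k _ => ?_
    rcases le_total 0 (|x k| - c) with h | h
    · rw [hv']
      simp [max_eq_right h]
    · have h0 : v' k = 0 := max_eq_left h
      rw [h0]
      exact mul_nonneg (by linarith) (by simpa using hv k)
  have h5 := hmin v' fun k => le_max_left _ _
  rw [h2, h3, ← hc] at h1
  simp only [Pi.zero_apply, mul_zero, Finset.sum_const_zero, ne_eq, OfNat.ofNat_ne_zero,
    not_false_eq_true, zero_pow, zero_div, add_zero] at h1
  have h6 : (v k - v' k) ^ 2 ≤ ∑ k, (v k - v' k) ^ 2 :=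
    Finset.single_le_sum (f := fun k => (v k - v' k) ^ 2) (fun k _ => sq_nonneg _)
      (Finset.mem_univ k)
  have h7 : (v k - v' k) ^ 2 = 0 := le_antisymm (by linarith) (sq_nonneg _)
  exact sub_eq_zero.1 (pow_eq_zero_iff (two_ne_zero) |>.1 h7)

theorem exists_prefix {a : Fin p → ℝ} (ha : Antitone a) (c : ℝ) :
    ∃ s ≤ p, ∀ k : Fin p, k.val < s ↔ c < a k := by
  classical
  have hex : ∃ s, ∀ k : Fin p, s ≤ k.val → a k ≤ c := ⟨p, fun k hk => by omega⟩
  refine ⟨Nat.find hex, Nat.find_min' hex fun k hk => by omega, fun k => ⟨fun hk => ?_, ?_⟩⟩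
  · have h := Nat.find_min hex hk
    push Not at h
    obtain ⟨l, hl, hcl⟩ := h
    exact hcl.trans_le (ha hl)
  · contrapose!
    exact Nat.find_spec hex k

/-- Some candidate of a feasible pair minimizes the row objective over all nonnegative vectors. -/
theorem exists_feasible_minimizer (hlam : 0 < lam) (hx : Antitone fun k => |x k|)
    (hy : Antitone fun j => |y j|) :
    ∃ s t, Feasible lam x y s t ∧ ∀ v w, 0 ≤ v → 0 ≤ w →
      rowObjective lam x y (candV lam x y s t) (candW lam x y s t) ≤
        rowObjective lam x y v w := by
  obtain ⟨v, w, hv, hw, hmin, hsum⟩ := exists_minimizer hlam x y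
  have hvk := eq_max_of_minimizer hv fun v' hv' => hmin v' w hv' hw
  have hwj := eq_max_of_minimizer (lam := lam) (x := y) (y := x) (w := v) hw fun w' hw' => by
    rw [rowObjective_comm, rowObjective_comm w']
    exact hmin v w' hv hw'
  obtain ⟨s, hs, hsk⟩ := exists_prefix hx (lam * ∑ j, w j)
  obtain ⟨t, ht, htj⟩ := exists_prefix hy (lam * ∑ k, v k)
  have hv' : v = fun k => if k.val < s then |x k| + -(lam * ∑ j, w j) else 0 := by
    funext k
    rw [hvk k]
    split_ifs with h
    · rw [max_eq_right (by linarith [(hsk k).1 h]), sub_eq_add_neg]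
    · rw [max_eq_left (by linarith [not_lt.1 fun h' => h ((hsk k).2 h')])]
  have hw' : w = fun j => if j.val < t then |y j| + -(lam * ∑ k, v k) else 0 := by
    funext j
    rw [hwj j]
    split_ifs with h
    · rw [max_eq_right (by linarith [(htj j).1 h]), sub_eq_add_neg]
    · rw [max_eq_left (by linarith [not_lt.1 fun h' => h ((htj j).2 h')])]
  have ha : ∑ k, v k = headSum x s + s * -(lam * ∑ j, w j) := by
    conv_lhs => rw [hv']
    exact sum_ite_lt_abs_add x hs _
  have hb : ∑ j, w j = headSum y t + t * -(lam * ∑ k, v k) := by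
    conv_lhs => rw [hw']
    exact sum_ite_lt_abs_add y ht _
  have hst : (s : ℝ) * t * lam ^ 2 < 1 := by
    by_contra! hge
    have hs0 : 0 < s := by
      rcases Nat.eq_zero_or_pos s with h | h
      · norm_num [h] at hge
      · exact h
    -- the objective does not increase if `ε` is subtracted on the support of `v` and
    -- `lam * s * ε` is added on the support of `w`: the first-order terms vanish, and the
    -- second-order term is `s * ε ^ 2 * (1 - s * t * lam ^ 2) / 2`
    obtain ⟨ε, hε, hεk⟩ : ∃ ε > 0, ∀ k : Fin p, k.val < s → ε ≤ v k := by
      refine ⟨|x ⟨s - 1, by omega⟩| - lam * ∑ j, w j,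
        sub_pos.2 ((hsk ⟨s - 1, by omega⟩).1 (by simp; omega)), fun k hk => ?_⟩
      have hle : |x ⟨s - 1, by omega⟩| ≤ |x k| := hx (show k ≤ ⟨s - 1, by omega⟩ from by
        rw [Fin.le_def]; simp; omega)
      rw [hvk k]
      exact le_max_of_le_right (by linarith)
    set d : Fin p → ℝ := fun k => if k.val < s then -ε else 0 with hd
    set e : Fin m → ℝ := fun j => if j.val < t then lam * s * ε else 0 with he
    have hsd : ∑ k, d k = s * -ε := sum_ite_lt_const hs _
    have hse : ∑ j, e j = t * (lam * s * ε) := sum_ite_lt_const ht _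
    have hsd2 : ∑ k, d k ^ 2 = s * (-ε) ^ 2 := by
      rw [← sum_ite_lt_const hs]
      exact Finset.sum_congr rfl fun k _ => by simp only [hd]; split_ifs <;> simp
    have hse2 : ∑ j, e j ^ 2 = t * (lam * s * ε) ^ 2 := by
      rw [← sum_ite_lt_const ht]
      exact Finset.sum_congr rfl fun j _ => by simp only [he]; split_ifs <;> simp
    have hgv : ∑ k, (v k - |x k| + lam * ∑ j, w j) * d k = 0 := by
      refine Finset.sum_eq_zero fun k _ => ?_
      by_cases h : k.val < s
      · rw [congrFun hv' k, if_pos h]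
        ring
      · simp [hd, h]
    have hgw : ∑ j, (w j - |y j| + lam * ∑ k, v k) * e j = 0 := by
      refine Finset.sum_eq_zero fun j _ => ?_
      by_cases h : j.val < t
      · rw [congrFun hw' j, if_pos h]
        ring
      · simp [he, h]
    have hval := rowObjective_add (lam := lam) (x := x) (y := y) v d w e
    rw [hgv, hgw, hsd, hse, hsd2, hse2] at hval
    have hneg : 0 ≤ s * ε ^ 2 * (s * t * lam ^ 2 - 1) :=
      mul_nonneg (by positivity) (by linarith)
    have hlt := hsum (fun k => v k + d k) (fun j => w j + e j) (fun k => ?_) (fun j => ?_)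
      (by linarith)
    · rw [Finset.sum_add_distrib, hsd] at hlt
      have : 0 < s * ε := by positivity
      linarith
    · simp only [hd, Pi.zero_apply]
      split_ifs with h
      · linarith [hεk k h]
      · simpa using hv k
    · simp only [he, Pi.zero_apply]
      have := hw j
      simp only [Pi.zero_apply] at this
      split_ifs <;> positivity
  have hov : offset lam s t (headSum x s) (headSum y t) = -(lam * ∑ j, w j) := by
    have h1 : 1 - (s : ℝ) * t * lam ^ 2 ≠ 0 := by linarith
    unfold offset
    rw [one_div, inv_mul_eq_iff_eq_mul₀ h1]
    rw [ha] at hb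
    linear_combination lam * hb
  have how : offset lam t s (headSum y t) (headSum x s) = -(lam * ∑ k, v k) := by
    have h1 : 1 - (t : ℝ) * s * lam ^ 2 ≠ 0 := by linarith [mul_comm (t : ℝ) s]
    unfold offset
    rw [one_div, inv_mul_eq_iff_eq_mul₀ h1]
    rw [hb] at ha
    linear_combination lam * ha
  have hcv : candV lam x y s t = v := by
    rw [hv']
    funext k
    rw [candV_apply, hov]
  have hcw : candW lam x y s t = w := by
    rw [hw']
    funext j
    rw [candW_apply, how]
  refine ⟨s, t, ⟨hs, ht, fun k _ => ?_, fun j _ => ?_, (mul_lt_inv_sq_iff hlam s t).2 hst⟩, ?_⟩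
  · rw [hcv]
    exact hv k
  · rw [hcw]
    exact hw j
  · rw [hcv, hcw]
    exact hmin

/-- A best candidate on the maximal feasibility boundary minimizes the row objective over all
nonnegative vectors. -/
theorem rowObjective_le_of_MFB_min (hlam : 0 < lam) (hx : Antitone fun k => |x k|)
    (hy : Antitone fun j => |y j|) {r : ℝ}
    (hr : ∀ t ∈ MFB lam x y,
      r ≤ rowObjective lam x y (candV lam x y t.1 t.2) (candW lam x y t.1 t.2))
    {v : Fin p → ℝ} {w : Fin m → ℝ} (hv : 0 ≤ v) (hw : 0 ≤ w) :
    r ≤ rowObjective lam x y v w := by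
  obtain ⟨s, t, hst, hmin⟩ := exists_feasible_minimizer hlam hx hy
  obtain ⟨u, hu, hle⟩ := hst.exists_mem_MFB_le hlam
  exact (hr u hu).trans (hle.trans (hmin v w hv hw))

end Minimizer

/-! ### From rows to matrices -/

section Matrix

variable {n p m : ℕ} {lam : ℝ}

theorem proxObjective_eq_sum (lam : ℝ) (X : Matrix (Fin n) (Fin p) ℝ)
    (Y : Matrix (Fin n) (Fin m) ℝ) (U : Matrix (Fin n) (Fin p) ℝ × Matrix (Fin n) (Fin m) ℝ) :
    proxObjective lam X Y U = ∑ i, ((1 / 2) * (∑ k, (U.1 i k - X i k) ^ 2) +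
      (1 / 2) * (∑ j, (U.2 i j - Y i j) ^ 2) + lam * (∑ k, |U.1 i k|) * ∑ j, |U.2 i j|) := by
  unfold proxObjective pathNorm
  rw [← Finset.sum_add_distrib, Finset.mul_sum, Finset.mul_sum, ← Finset.sum_add_distrib]
  refine Finset.sum_congr rfl fun i _ => ?_
  have h : ∑ j, ∑ k, |U.2 i j * U.1 i k| = (∑ k, |U.1 i k|) * ∑ j, |U.2 i j| := by
    rw [mul_comm, Finset.sum_mul_sum]
    exact Finset.sum_congr rfl fun j _ => Finset.sum_congr rfl fun k _ => abs_mul _ _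
  rw [h]
  ring

/-- Restoring the signs turns rowwise minimizers over nonnegative vectors into a minimizer of the
proximal problem. -/
theorem proxObjective_sign_le (hlam : 0 < lam) (X : Matrix (Fin n) (Fin p) ℝ)
    (Y : Matrix (Fin n) (Fin m) ℝ) (v : Fin n → Fin p → ℝ) (w : Fin n → Fin m → ℝ)
    (hv : ∀ i, 0 ≤ v i) (hw : ∀ i, 0 ≤ w i)
    (hmin : ∀ i v' w', 0 ≤ v' → 0 ≤ w' →
      rowObjective lam (X i) (Y i) (v i) (w i) ≤ rowObjective lam (X i) (Y i) v' w')
    (U : Matrix (Fin n) (Fin p) ℝ × Matrix (Fin n) (Fin m) ℝ) :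
    proxObjective lam X Y (Matrix.of fun i k => Real.sign (X i k) * v i k,
      Matrix.of fun i j => Real.sign (Y i j) * w i j) ≤ proxObjective lam X Y U := by
  have habs (a b : ℝ) (hb : 0 ≤ b) : |Real.sign a * b| ≤ b := by
    rcases Real.sign_apply_eq a with h | h | h <;> simp [h, hb, abs_of_nonneg hb]
  have hsq (a b : ℝ) : (Real.sign a * b - a) ^ 2 ≤ (b - |a|) ^ 2 := by
    rcases lt_trichotomy a 0 with h | h | h
    · rw [Real.sign_of_neg h, abs_of_neg h]
      linarith
    · simp [h, sq_nonneg]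
    · rw [Real.sign_of_pos h, abs_of_pos h, one_mul]
  have hsq' (a b : ℝ) : (|b| - |a|) ^ 2 ≤ (b - a) ^ 2 :=
    sq_le_sq.2 (abs_abs_sub_abs_le b a)
  rw [proxObjective_eq_sum, proxObjective_eq_sum]
  refine Finset.sum_le_sum fun i _ => ?_
  calc _ ≤ rowObjective lam (X i) (Y i) (v i) (w i) := by
        refine objective_mono hlam.le (Finset.sum_le_sum fun k _ => hsq _ _)
          (Finset.sum_le_sum fun j _ => hsq _ _) (Finset.sum_le_sum fun k _ => habs _ _ (hv i k))
          (Finset.sum_le_sum fun j _ => habs _ _ (hw i j)) ?_ ?_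
        · exact Finset.sum_nonneg fun k _ => hv i k
        · exact Finset.sum_nonneg fun j _ => abs_nonneg _
    _ ≤ rowObjective lam (X i) (Y i) (fun k => |U.1 i k|) (fun j => |U.2 i j|) :=
        hmin i _ _ (fun _ => abs_nonneg _) (fun _ => abs_nonneg _)
    _ ≤ _ := by
        refine objective_mono hlam.le (Finset.sum_le_sum fun k _ => hsq' _ _)
          (Finset.sum_le_sum fun j _ => hsq' _ _) le_rfl le_rfl ?_ ?_
        · exact Finset.sum_nonneg fun k _ => abs_nonneg _
        · exact Finset.sum_nonneg fun j _ => abs_nonneg _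

end Matrix

/-! ### Runs of programs and their lengths -/

namespace Prog

variable {α β : Type}

@[simp]
theorem run_pure (a : α) : (pure a : Prog ℝ (ℕ → ℝ) α).run = a := rfl

@[simp]
theorem steps_pure (a : α) : (pure a : Prog ℝ (ℕ → ℝ) α).steps = 0 := rfl

theorem run_andThen (q : Prog ℝ (ℕ → ℝ) α) (f : α → Prog ℝ (ℕ → ℝ) β) :
    (q.andThen f).run = (f q.run).run := by
  induction q with
  | ret a => rfl
  | nat n k ih => exact ih _
  | un o a k ih => exact ih _
  | bin o a b k ih => exact ih _
  | lt a b k ih => exact ih _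
  | alloc n k ih => exact ih _
  | read a i k ih => exact ih _
  | write a i r k ih => exact ih _
  | tick k ih => exact ih

theorem steps_andThen (q : Prog ℝ (ℕ → ℝ) α) (f : α → Prog ℝ (ℕ → ℝ) β) :
    (q.andThen f).steps = q.steps + (f q.run).steps := by
  induction q with
  | ret a => simp [andThen, steps, run]
  | nat n k ih => simp only [andThen, steps, run, ih]; omega
  | un o a k ih => simp only [andThen, steps, run, ih]; omega
  | bin o a b k ih => simp only [andThen, steps, run, ih]; omega
  | lt a b k ih => simp only [andThen, steps, run, ih]; omega
  | alloc n k ih => simp only [andThen, steps, run, ih]; omega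
  | read a i k ih => simp only [andThen, steps, run, ih]; omega
  | write a i r k ih => simp only [andThen, steps, run, ih]; omega
  | tick k ih => simp only [andThen, steps, run, ih]; omega

@[simp]
theorem run_bind (q : Prog ℝ (ℕ → ℝ) α) (f : α → Prog ℝ (ℕ → ℝ) β) :
    (q >>= f).run = (f q.run).run := run_andThen q f

@[simp]
theorem steps_bind (q : Prog ℝ (ℕ → ℝ) α) (f : α → Prog ℝ (ℕ → ℝ) β) :
    (q >>= f).steps = q.steps + (f q.run).steps := steps_andThen q f

end Prog

section Instructions

@[simp] theorem run_natR (n : ℕ) : (natR n : Prog ℝ (ℕ → ℝ) ℝ).run = n := rfl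
@[simp] theorem run_absR (a : ℝ) : (absR a : Prog ℝ (ℕ → ℝ) ℝ).run = |a| := rfl
@[simp] theorem run_signR (a : ℝ) : (signR a : Prog ℝ (ℕ → ℝ) ℝ).run = Real.sign a := rfl
@[simp] theorem run_addR (a b : ℝ) : (addR a b : Prog ℝ (ℕ → ℝ) ℝ).run = a + b := rfl
@[simp] theorem run_subR (a b : ℝ) : (subR a b : Prog ℝ (ℕ → ℝ) ℝ).run = a - b := rfl
@[simp] theorem run_mulR (a b : ℝ) : (mulR a b : Prog ℝ (ℕ → ℝ) ℝ).run = a * b := rfl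
@[simp] theorem run_divR (a b : ℝ) : (divR a b : Prog ℝ (ℕ → ℝ) ℝ).run = a / b := rfl
open Classical in
@[simp] theorem run_ltR (a b : ℝ) : (ltR a b : Prog ℝ (ℕ → ℝ) Bool).run = decide (a < b) := rfl
@[simp] theorem run_newArr (n : ℕ) :
    (newArr n : Prog ℝ (ℕ → ℝ) (ℕ → ℝ)).run = fun _ => 0 := rfl
@[simp] theorem run_readA (a : ℕ → ℝ) (i : ℕ) : (readA a i : Prog ℝ (ℕ → ℝ) ℝ).run = a i := rfl
open Classical in
@[simp] theorem run_writeA (a : ℕ → ℝ) (i : ℕ) (r : ℝ) :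
    (writeA a i r : Prog ℝ (ℕ → ℝ) (ℕ → ℝ)).run = Function.update a i r := by
  simp only [writeA, Prog.run]

@[simp] theorem steps_natR (n : ℕ) : (natR n : Prog ℝ (ℕ → ℝ) ℝ).steps = 1 := rfl
@[simp] theorem steps_absR (a : ℝ) : (absR a : Prog ℝ (ℕ → ℝ) ℝ).steps = 1 := rfl
@[simp] theorem steps_signR (a : ℝ) : (signR a : Prog ℝ (ℕ → ℝ) ℝ).steps = 1 := rfl
@[simp] theorem steps_addR (a b : ℝ) : (addR a b : Prog ℝ (ℕ → ℝ) ℝ).steps = 1 := rfl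
@[simp] theorem steps_subR (a b : ℝ) : (subR a b : Prog ℝ (ℕ → ℝ) ℝ).steps = 1 := rfl
@[simp] theorem steps_mulR (a b : ℝ) : (mulR a b : Prog ℝ (ℕ → ℝ) ℝ).steps = 1 := rfl
@[simp] theorem steps_divR (a b : ℝ) : (divR a b : Prog ℝ (ℕ → ℝ) ℝ).steps = 1 := rfl
@[simp] theorem steps_ltR (a b : ℝ) : (ltR a b : Prog ℝ (ℕ → ℝ) Bool).steps = 1 := rfl
@[simp] theorem steps_newArr (n : ℕ) :
    (newArr n : Prog ℝ (ℕ → ℝ) (ℕ → ℝ)).steps = n + 1 := by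
  simp [newArr, Prog.steps]
@[simp] theorem steps_readA (a : ℕ → ℝ) (i : ℕ) :
    (readA a i : Prog ℝ (ℕ → ℝ) ℝ).steps = 1 := rfl
@[simp] theorem steps_writeA (a : ℕ → ℝ) (i : ℕ) (r : ℝ) :
    (writeA a i r : Prog ℝ (ℕ → ℝ) (ℕ → ℝ)).steps = 1 := rfl
@[simp] theorem steps_tick : (tick : Prog ℝ (ℕ → ℝ) Unit).steps = 1 := rfl

variable {σ : Type}

/-- The run of a loop follows any sequence of states that is compatible with its body. -/
theorem run_forLoop {n : ℕ} {s : σ} {body : ℕ → σ → Prog ℝ (ℕ → ℝ) σ} (g : ℕ → σ)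
    (h0 : g 0 = s) (hstep : ∀ k < n, (body k (g k)).run = g (k + 1)) :
    (forLoop n s body).run = g n := by
  induction n with
  | zero => exact h0.symm
  | succ n ih =>
    simp only [forLoop, Prog.run_bind]
    rw [ih fun k hk => hstep k (by omega), hstep n (by omega)]

theorem steps_forLoop_le {c : ℕ} (n : ℕ) (s : σ) (body : ℕ → σ → Prog ℝ (ℕ → ℝ) σ)
    (h : ∀ k s, (body k s).steps ≤ c) : (forLoop n s body).steps ≤ (c + 1) * n := by
  induction n with
  | zero => simp [forLoop]
  | succ n ih =>
    simp only [forLoop, Prog.steps_bind, steps_tick]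
    have := h n (forLoop n s body).run
    rw [mul_add]
    omega

theorem steps_forList_le {c : ℕ} (S : List (ℕ × ℕ)) (s : σ)
    (body : ℕ × ℕ → σ → Prog ℝ (ℕ → ℝ) σ) (h : ∀ r ∈ S, ∀ s, (body r s).steps ≤ c) :
    (forList S s body).steps ≤ S.length * (c + 1) := by
  induction S generalizing s with
  | nil => simp [forList]
  | cons r S ih =>
    simp only [forList, Prog.steps_bind, steps_tick, List.length_cons]
    have h1 := h r (by simp) s
    have h2 := ih (body r s).run fun r' hr' => h r' (by simp [hr'])
    rw [add_mul]
    omega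

end Instructions

/-! ### The subroutines -/

section Subroutines

theorem run_cumSums (x : ℕ → ℝ) (n : ℕ) : (cumSums x n : Prog ℝ (ℕ → ℝ) (ℕ → ℝ)).run =
    fun s => if s ≤ n then ∑ k ∈ Finset.range s, |x k| else 0 := by
  simp only [cumSums, Prog.run_bind]
  refine run_forLoop
    (fun n s => if s ≤ n then ∑ k ∈ Finset.range s, |x k| else (0 : ℝ)) ?_ fun k _ => ?_
  · funext s
    by_cases hs : s = 0 <;> simp [hs]
  · funext s
    simp only [Prog.run_bind, run_readA, run_absR, run_addR, run_writeA, le_refl, if_true,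
      Function.update_apply]
    by_cases hs : s = k + 1
    · simp [hs, Finset.sum_range_succ]
    · have : s ≤ k ↔ s ≤ k + 1 := by omega
      simp [hs, this]

theorem run_absSum (x : ℕ → ℝ) (n : ℕ) :
    (absSum x n : Prog ℝ (ℕ → ℝ) ℝ).run = ∑ k ∈ Finset.range n, |x k| := by
  simp only [absSum, Prog.run_bind]
  exact run_forLoop (fun n => ∑ k ∈ Finset.range n, |x k|) (by simp)
    fun k _ => by simp [Finset.sum_range_succ]

theorem run_arrSum (v : ℕ → ℝ) (n : ℕ) :
    (arrSum v n : Prog ℝ (ℕ → ℝ) ℝ).run = ∑ k ∈ Finset.range n, v k := by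
  simp only [arrSum, Prog.run_bind]
  exact run_forLoop (fun n => ∑ k ∈ Finset.range n, v k) (by simp)
    fun k _ => by simp [Finset.sum_range_succ]

theorem run_sqDist (v x : ℕ → ℝ) (n : ℕ) : (sqDist v x n : Prog ℝ (ℕ → ℝ) ℝ).run =
    ∑ k ∈ Finset.range n, (v k - |x k|) ^ 2 := by
  simp only [sqDist, Prog.run_bind]
  exact run_forLoop (fun n => ∑ k ∈ Finset.range n, (v k - |x k|) ^ 2) (by simp)
    fun k _ => by simp [Finset.sum_range_succ, sq]

theorem run_fillArr (x : ℕ → ℝ) (n s : ℕ) (c : ℝ) :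
    (fillArr x n s c : Prog ℝ (ℕ → ℝ) (ℕ → ℝ)).run =
      fun i => if i < s then |x i| + c else 0 := by
  simp only [fillArr, Prog.run_bind]
  refine run_forLoop (fun s i => if i < s then |x i| + c else (0 : ℝ)) (by simp) fun k _ => ?_
  funext i
  simp only [Prog.run_bind, run_readA, run_absR, run_addR, run_writeA, Function.update_apply]
  by_cases hi : i = k
  · simp [hi]
  · have : i < k ↔ i < k + 1 := by omega
    simp [hi, this]

theorem run_applySign (x v : ℕ → ℝ) (n : ℕ) :
    (applySign x v n : Prog ℝ (ℕ → ℝ) (ℕ → ℝ)).run =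
      fun i => if i < n then Real.sign (x i) * v i else 0 := by
  simp only [applySign, Prog.run_bind]
  refine run_forLoop (fun n i => if i < n then Real.sign (x i) * v i else (0 : ℝ)) (by simp)
    fun k _ => ?_
  funext i
  simp only [Prog.run_bind, run_readA, run_signR, run_mulR, run_writeA, Function.update_apply]
  by_cases hi : i = k
  · simp [hi]
  · have : i < k ↔ i < k + 1 := by omega
    simp [hi, this]

@[simp]
theorem run_shift (lam : ℝ) (s t : ℕ) (a b : ℝ) :
    (shift lam s t a b : Prog ℝ (ℕ → ℝ) ℝ).run = offset lam s t a b := by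
  simp [shift, offset, sq]

theorem run_evalObjective {p m : ℕ} (lam : ℝ) (x : Fin p → ℝ) (y : Fin m → ℝ) (v w : ℕ → ℝ) :
    (evalObjective p m lam (toArr x) (toArr y) v w : Prog ℝ (ℕ → ℝ) ℝ).run =
      rowObjective lam x y (ofArr p v) (ofArr m w) := by
  have h1 (n : ℕ) (z : Fin n → ℝ) (u : ℕ → ℝ) :
      ∑ k ∈ Finset.range n, (u k - |toArr z k|) ^ 2 = ∑ k, (ofArr n u k - |z k|) ^ 2 := by
    rw [← Fin.sum_univ_eq_sum_range]
    simp [toArr, ofArr]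
  have h2 (n : ℕ) (u : ℕ → ℝ) : ∑ k ∈ Finset.range n, u k = ∑ k, ofArr n u k :=
    (Fin.sum_univ_eq_sum_range _ _).symm
  simp only [evalObjective, Prog.run_bind, run_sqDist, run_arrSum, run_addR, run_natR, run_divR,
    run_mulR, h1, h2, rowObjective]
  push_cast
  ring

theorem run_candidate {p m : ℕ} (lam : ℝ) (x : Fin p → ℝ) (y : Fin m → ℝ) (s t : ℕ) :
    ofArr p (candidate p m lam (toArr x) (toArr y) s t : Prog ℝ (ℕ → ℝ) _).run.1 =
        candV lam x y s t ∧
      ofArr m (candidate p m lam (toArr x) (toArr y) s t : Prog ℝ (ℕ → ℝ) _).run.2 =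
        candW lam x y s t := by
  simp only [candidate, Prog.run_bind, run_absSum, run_shift, run_fillArr, Prog.run_pure,
    ← headSum_eq_sum_range]
  exact ⟨funext fun k => by simp [ofArr, toArr, candV_apply],
    funext fun j => by simp [ofArr, toArr, candW_apply]⟩

open Classical in
theorem run_lastNegative {p : ℕ} (x : Fin p → ℝ) (lam : ℝ) {s : ℕ} (hs : s ≤ p) (t : ℕ)
    (a b : ℝ) : (lastNegative (toArr x) lam s t a b : Prog ℝ (ℕ → ℝ) Bool).run =
      !decide (∀ k : Fin p, k.val + 1 = s → 0 ≤ |x k| + offset lam s t a b) := by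
  cases s with
  | zero => simp [lastNegative]
  | succ s =>
    have h : (∀ k : Fin p, k.val + 1 = s + 1 → 0 ≤ |x k| + offset lam (s + 1) t a b) ↔
        ¬ |toArr x s| + offset lam (s + 1) t a b < 0 := by
      rw [not_lt, show toArr x s = x ⟨s, hs⟩ from dif_pos _]
      refine ⟨fun h => h ⟨s, hs⟩ rfl, fun h k hk => ?_⟩
      rwa [show k = ⟨s, hs⟩ from Fin.ext (by simpa using hk)]
    simp only [h, decide_not, Bool.not_not]
    simp [lastNegative]

open Classical in
theorem run_feasibleTest {p m : ℕ} (lam : ℝ) (x : Fin p → ℝ) (y : Fin m → ℝ) {s t : ℕ}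
    (hs : s ≤ p) (ht : t ≤ m) :
    (feasibleTest lam (toArr x) (toArr y)
      (cumSums (toArr x) p : Prog ℝ (ℕ → ℝ) (ℕ → ℝ)).run
      (cumSums (toArr y) m : Prog ℝ (ℕ → ℝ) (ℕ → ℝ)).run s t : Prog ℝ (ℕ → ℝ) Bool).run =
      decide (Feasible lam x y s t) := by
  have hV : (∀ k : Fin p, k.val + 1 = s → 0 ≤ candV lam x y s t k) ↔
      ∀ k : Fin p, k.val + 1 = s →
        0 ≤ |x k| + offset lam s t (headSum x s) (headSum y t) :=
    forall₂_congr fun k hk => by rw [candV_apply, if_pos (by omega)]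
  have hW : (∀ j : Fin m, j.val + 1 = t → 0 ≤ candW lam x y s t j) ↔
      ∀ j : Fin m, j.val + 1 = t →
        0 ≤ |y j| + offset lam t s (headSum y t) (headSum x s) :=
    forall₂_congr fun j hj => by rw [candW_apply, if_pos (by omega)]
  have hsmall : (productSmall lam s t : Prog ℝ (ℕ → ℝ) Bool).run =
      decide ((s : ℝ) * t < (lam ^ 2)⁻¹) := by
    simp [productSmall, sq]
  simp only [feasibleTest, Prog.run_bind, hsmall, Feasible, hV, hW]
  by_cases h : (s : ℝ) * t < (lam ^ 2)⁻¹
  · simp only [h, decide_true, if_true, Prog.run_bind, run_readA, run_cumSums, hs, ht,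
      Prog.run_pure, ← headSum_eq_sum_range, run_lastNegative x lam hs,
      run_lastNegative y lam ht, Bool.not_not, true_and, and_true, Bool.decide_and]
  · simp [h]

end Subroutines

/-! ### Correctness of the boundary algorithm -/

section Boundary

variable {p m : ℕ} {lam : ℝ} {x : Fin p → ℝ} {y : Fin m → ℝ}

/-- A boundary pair is the topmost feasible pair with its first component. -/
theorem eq_of_mem_MFB (hlam : 0 < lam) (hx : Antitone fun k => |x k|)
    (hy : Antitone fun j => |y j|) {r : ℕ × ℕ} {b : ℕ} (hr : r ∈ MFB lam x y)
    (hb : Feasible lam x y r.1 b) (hle : r.2 ≤ b) : r.2 = b := by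
  by_contra hne
  exact hr.2.2 (hb.mono hlam hx hy le_rfl (by omega))

/-- The loop adds to `S` the boundary pairs that lie ahead of the walk. If the flag is set, the
walk has just moved from the feasible pair `(sv - 1, sw)`, above which nothing is feasible and which
may still have to be recorded, or it is at its start; otherwise it has just moved down from an
infeasible pair. -/
theorem mem_run_boundaryLoop (hlam : 0 < lam) (hx : Antitone fun k => |x k|)
    (hy : Antitone fun j => |y j|) (sv sw1 : ℕ) (flag : Bool) (S : List (ℕ × ℕ))
    (hsw : sw1 ≤ m + 1) (hsv : sv ≤ p + 1)
    (htrue : flag = true → (sv = 0 ∧ sw1 = m + 1) ∨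
      ∃ s sw, sv = s + 1 ∧ sw1 = sw + 1 ∧ Feasible lam x y s sw ∧ ¬ Feasible lam x y s (sw + 1))
    (hfalse : flag = false → sv ≤ p ∧ ¬ Feasible lam x y sv sw1) (r : ℕ × ℕ) :
    r ∈ (boundaryLoop p lam (toArr x) (toArr y)
        (cumSums (toArr x) p : Prog ℝ (ℕ → ℝ) (ℕ → ℝ)).run
        (cumSums (toArr y) m : Prog ℝ (ℕ → ℝ) (ℕ → ℝ)).run sv sw1 flag S :
          Prog ℝ (ℕ → ℝ) _).run ↔
      r ∈ S ∨ (r ∈ MFB lam x y ∧ r.2 < sw1 ∧ (sv ≤ r.1 ∨ (flag = true ∧ r.1 + 1 = sv))) := by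
  induction hn : (p + 1 - sv) + sw1 using Nat.strong_induction_on generalizing sv sw1 flag S with
  | _ n ih =>
    cases sw1 with
    | zero => simp [boundaryLoop]
    | succ sw =>
      rw [boundaryLoop]
      by_cases hp : p < sv
      · rw [dif_pos hp]
        have hflag : flag = true := by
          cases flag with
          | false => have := (hfalse rfl).1; omega
          | true => rfl
        obtain ⟨h0, -⟩ | ⟨s, sw', rfl, hsw', hf, hnf⟩ := htrue hflag
        · omega
        obtain rfl : sw' = sw := by omega
        simp only [Prog.run_bind, Prog.run_pure, List.mem_cons, Nat.add_sub_cancel]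
        rw [or_comm]
        refine or_congr_right ⟨?_, fun ⟨hr, hlt, hor⟩ => ?_⟩
        · rintro rfl
          refine ⟨⟨hf, fun h => ?_, hnf⟩, by simp, by simp [hflag]⟩
          have := h.1
          omega
        · have h1 : r.1 ≤ p := hr.1.1
          obtain rfl : r.1 = s := by omega
          exact Prod.ext rfl (eq_of_mem_MFB hlam hx hy hr hf (by omega))
      · rw [dif_neg hp]
        simp only [Prog.run_bind, run_feasibleTest lam x y (not_lt.1 hp) (by omega : sw ≤ m)]
        by_cases hf : Feasible lam x y sv sw
        · have hup : ¬ Feasible lam x y sv (sw + 1) := by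
            cases flag with
            | false => exact (hfalse rfl).2
            | true =>
              obtain ⟨-, h⟩ | ⟨s, sw', rfl, hsw', -, hnf⟩ := htrue rfl
              · intro h'
                have := h'.2.1
                omega
              · obtain rfl : sw' = sw := by omega
                exact fun h' => hnf (h'.mono hlam hx hy (by omega) le_rfl)
          simp only [hf, decide_true, if_true, Prog.run_bind]
          rw [ih _ (by omega) (sv + 1) (sw + 1) true S hsw (by omega)
            (fun _ => .inr ⟨sv, sw, rfl, rfl, hf, hup⟩) (by simp) rfl]
          refine or_congr_right (and_congr_right fun hr => and_congr_right fun hlt => ?_)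
          have : r.1 + 1 ≠ sv := fun h =>
            hr.2.1 (h ▸ hf.mono hlam hx hy le_rfl (by omega))
          simp only [true_and]
          omega
        · simp only [hf, decide_false, Bool.false_eq_true, if_false, Prog.run_bind]
          rw [ih _ (by omega) sv sw false _ (by omega) hsv (by simp)
            (fun _ => ⟨not_lt.1 hp, hf⟩) rfl]
          have hne (hr : r ∈ MFB lam x y) (hle : sv ≤ r.1) : r.2 ≠ sw := fun h =>
            hf (hr.1.mono hlam hx hy hle h.ge)
          cases flag with
          | false =>
            simp only [Bool.false_eq_true, if_false, false_and, or_false]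
            refine or_congr_right (and_congr_right fun hr => ?_)
            have := hne hr
            omega
          | true =>
            obtain ⟨rfl, h⟩ | ⟨s, sw', rfl, hsw', hf', hnf⟩ := htrue rfl
            · exact absurd (feasible_zero_left hlam (by omega)) hf
            obtain rfl : sw' = sw := by omega
            have hrow : r = (s, sw') ↔ r ∈ MFB lam x y ∧ r.2 < sw' + 1 ∧ r.1 + 1 = s + 1 := by
              refine ⟨?_, fun ⟨hr, hlt, h⟩ => ?_⟩
              · rintro rfl
                exact ⟨⟨hf', hf, hnf⟩, by simp, rfl⟩
              · obtain rfl : r.1 = s := by omega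
                exact Prod.ext rfl (eq_of_mem_MFB hlam hx hy hr hf' (by omega))
            simp only [if_true, List.mem_cons, Nat.add_sub_cancel, hrow, Bool.false_eq_true,
              false_and, or_false, true_and]
            constructor
            · rintro ((⟨h1, h2, h3⟩ | h) | ⟨h1, h2, h3⟩)
              · exact .inr ⟨h1, h2, .inr h3⟩
              · exact .inl h
              · exact .inr ⟨h1, by omega, .inl h3⟩
            · rintro (h | ⟨h1, h2, h3 | h3⟩)
              · exact .inl (.inr h)
              · have := hne h1 h3
                exact .inr ⟨h1, by omega, h3⟩
              · exact .inl (.inl ⟨h1, h2, h3⟩)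

theorem mem_run_boundaryAlg (hlam : 0 < lam) (hx : Antitone fun k => |x k|)
    (hy : Antitone fun j => |y j|) (r : ℕ × ℕ) :
    r ∈ (boundaryProg lam x y).run ↔ r ∈ MFB lam x y := by
  simp only [boundaryProg, boundaryAlg, Prog.run_bind]
  rw [mem_run_boundaryLoop hlam hx hy 0 (m + 1) true [] le_rfl (by omega)
    (fun _ => .inl ⟨rfl, rfl⟩) (by simp)]
  simp only [List.not_mem_nil, false_or, Nat.zero_le, true_or, and_true]
  refine ⟨fun h => h.1, fun h => ⟨h, ?_⟩⟩
  have := h.1.2.1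
  omega

end Boundary

/-! ### Correctness of the proximal algorithm -/

section Prox

variable {p m : ℕ} {lam : ℝ} {x : Fin p → ℝ} {y : Fin m → ℝ}

/-- The invariant of the main loop: the current point is the best one of the candidates that have
been evaluated. -/
def LoopState.IsBest (lam : ℝ) (x : Fin p → ℝ) (y : Fin m → ℝ) (st : LoopState ℝ (ℕ → ℝ)) :
    Prop :=
  (st.evaluated = [] ∧ st.best = none) ∨
    ∃ s ∈ st.evaluated,
      st.best = some (rowObjective lam x y (candV lam x y s.1 s.2) (candW lam x y s.1 s.2)) ∧
      ofArr p st.v = candV lam x y s.1 s.2 ∧ ofArr m st.w = candW lam x y s.1 s.2 ∧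
      ∀ t ∈ st.evaluated, rowObjective lam x y (candV lam x y s.1 s.2) (candW lam x y s.1 s.2) ≤
        rowObjective lam x y (candV lam x y t.1 t.2) (candW lam x y t.1 t.2)

theorem run_loopBody (s : ℕ × ℕ) {st : LoopState ℝ (ℕ → ℝ)} (hst : st.IsBest lam x y) :
    (loopBody p m lam (toArr x) (toArr y) s st).run.IsBest lam x y ∧
      (loopBody p m lam (toArr x) (toArr y) s st).run.evaluated = s :: st.evaluated := by
  obtain ⟨hv, hw⟩ := run_candidate lam x y s.1 s.2
  simp only [loopBody, Prog.run_bind, run_evalObjective, hv, hw]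
  rcases st with ⟨best, v, w, ev⟩
  obtain ⟨h1, h2⟩ | ⟨r, hr, h2, hrv, hrw, hmin⟩ := hst
  · dsimp only at h1 h2
    subst h1 h2
    simp only [Prog.run_pure, if_true, Prog.run_bind, and_true]
    exact .inr ⟨s, by simp, rfl, hv, hw, by simp⟩
  · dsimp only at h2 hr hrv hrw hmin
    subst h2
    simp only [run_ltR, decide_eq_true_eq]
    split_ifs with hlt
    · simp only [Prog.run_pure, Prog.run_bind, and_true]
      refine .inr ⟨s, by simp, rfl, hv, hw, fun t ht => ?_⟩
      obtain rfl | ht := List.mem_cons.1 ht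
      · exact le_rfl
      · exact hlt.le.trans (hmin t ht)
    · simp only [Prog.run_pure, and_true]
      refine .inr ⟨r, by simp [hr], rfl, hrv, hrw, fun t ht => ?_⟩
      obtain rfl | ht := List.mem_cons.1 ht
      · exact not_lt.1 hlt
      · exact hmin t ht

theorem run_forList_loopBody (S : List (ℕ × ℕ)) {st : LoopState ℝ (ℕ → ℝ)}
    (hst : st.IsBest lam x y) :
    (forList S st fun s st => loopBody p m lam (toArr x) (toArr y) s st).run.IsBest lam x y ∧
      ∀ r, r ∈ (forList S st fun s st =>
        loopBody p m lam (toArr x) (toArr y) s st).run.evaluated ↔ r ∈ S ∨ r ∈ st.evaluated := by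
  induction S generalizing st with
  | nil => simpa [forList] using hst
  | cons s S ih =>
    obtain ⟨h1, h2⟩ := run_loopBody s hst
    obtain ⟨h3, h4⟩ := ih h1
    simp only [forList, Prog.run_bind]
    refine ⟨h3, fun r => ?_⟩
    rw [h4, h2, List.mem_cons, List.mem_cons]
    tauto

theorem run_proxProg (hlam : 0 < lam) (hx : Antitone fun k => |x k|)
    (hy : Antitone fun j => |y j|) :
    (∀ r, r ∈ (proxProg lam x y).run.evaluated ↔ r ∈ MFB lam x y) ∧
      ∃ s ∈ MFB lam x y,
        (ofArr p (proxProg lam x y).run.v = fun k => Real.sign (x k) * candV lam x y s.1 s.2 k) ∧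
        (ofArr m (proxProg lam x y).run.w = fun j => Real.sign (y j) * candW lam x y s.1 s.2 j) ∧
        ∀ t ∈ MFB lam x y,
          rowObjective lam x y (candV lam x y s.1 s.2) (candW lam x y s.1 s.2) ≤
            rowObjective lam x y (candV lam x y t.1 t.2) (candW lam x y t.1 t.2) := by
  have hS := mem_run_boundaryAlg hlam hx hy
  unfold boundaryProg at hS
  simp only [proxProg, proxAlg, Prog.run_bind, Prog.run_pure, run_newArr, run_applySign]
  set S := (boundaryAlg p m lam (toArr x) (toArr y) : Prog ℝ (ℕ → ℝ) _).run
  obtain ⟨hbest, hev⟩ := run_forList_loopBody (lam := lam) (x := x) (y := y) S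
    (st := ⟨none, fun _ => 0, fun _ => 0, []⟩) (.inl ⟨rfl, rfl⟩)
  set st := (forList S (⟨none, fun _ => 0, fun _ => 0, []⟩ : LoopState ℝ (ℕ → ℝ)) fun s st =>
    loopBody p m lam (toArr x) (toArr y) s st).run
  have hev' (r : ℕ × ℕ) : r ∈ st.evaluated ↔ r ∈ MFB lam x y := by
    rw [hev, ← hS]
    simp
  refine ⟨hev', ?_⟩
  obtain ⟨h, -⟩ | ⟨s, hs, -, hv, hw, hmin⟩ := hbest
  · obtain ⟨r, hr, -⟩ :=
      (feasible_zero_left (x := x) (y := y) hlam (Nat.zero_le m)).exists_mem_MFB_le hlam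
    rw [← hev', h] at hr
    simp at hr
  · refine ⟨s, (hev' s).1 hs, ?_, ?_, fun t ht => hmin t ((hev' t).2 ht)⟩
    · funext k
      rw [← hv]
      simp [ofArr, toArr]
    · funext j
      rw [← hw]
      simp [ofArr, toArr]

end Prox

/-! ### Running times -/

section Steps

theorem steps_cumSums_le (x : ℕ → ℝ) (n : ℕ) :
    (cumSums x n : Prog ℝ (ℕ → ℝ) (ℕ → ℝ)).steps ≤ 6 * n + (n + 2) := by
  simp only [cumSums, Prog.steps_bind, steps_newArr]
  have := steps_forLoop_le (c := 5) n (newArr (n + 1) : Prog ℝ (ℕ → ℝ) (ℕ → ℝ)).run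
    (fun k P => do
      let a ← readA x k
      let b ← absR a
      let c ← readA P k
      let d ← addR c b
      writeA P (k + 1) d) (by simp)
  omega

theorem steps_absSum_le (x : ℕ → ℝ) (n : ℕ) :
    (absSum x n : Prog ℝ (ℕ → ℝ) ℝ).steps ≤ 4 * n + 1 := by
  simp only [absSum, Prog.steps_bind, steps_natR, add_comm 1]
  exact Nat.add_le_add_right (steps_forLoop_le _ _ _ (by simp)) 1

theorem steps_arrSum_le (v : ℕ → ℝ) (n : ℕ) :
    (arrSum v n : Prog ℝ (ℕ → ℝ) ℝ).steps ≤ 3 * n + 1 := by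
  simp only [arrSum, Prog.steps_bind, steps_natR, add_comm 1]
  exact Nat.add_le_add_right (steps_forLoop_le _ _ _ (by simp)) 1

theorem steps_sqDist_le (v x : ℕ → ℝ) (n : ℕ) :
    (sqDist v x n : Prog ℝ (ℕ → ℝ) ℝ).steps ≤ 7 * n + 1 := by
  simp only [sqDist, Prog.steps_bind, steps_natR, add_comm 1]
  exact Nat.add_le_add_right (steps_forLoop_le _ _ _ (by simp)) 1

theorem steps_fillArr_le (x : ℕ → ℝ) (n s : ℕ) (c : ℝ) :
    (fillArr x n s c : Prog ℝ (ℕ → ℝ) (ℕ → ℝ)).steps ≤ 5 * s + (n + 1) := by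
  simp only [fillArr, Prog.steps_bind, steps_newArr, add_comm (n + 1)]
  exact Nat.add_le_add_right (steps_forLoop_le _ _ _ (by simp)) _

theorem steps_applySign_le (x v : ℕ → ℝ) (n : ℕ) :
    (applySign x v n : Prog ℝ (ℕ → ℝ) (ℕ → ℝ)).steps ≤ 6 * n + (n + 1) := by
  simp only [applySign, Prog.steps_bind, steps_newArr, add_comm (n + 1)]
  exact Nat.add_le_add_right (steps_forLoop_le _ _ _ (by simp)) _

@[simp]
theorem steps_shift (lam : ℝ) (s t : ℕ) (a b : ℝ) :
    (shift lam s t a b : Prog ℝ (ℕ → ℝ) ℝ).steps = 13 := by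
  simp [shift]

theorem steps_lastNegative_le (x : ℕ → ℝ) (lam : ℝ) (s t : ℕ) (a b : ℝ) :
    (lastNegative x lam s t a b : Prog ℝ (ℕ → ℝ) Bool).steps ≤ 19 := by
  cases s <;> simp [lastNegative]

theorem steps_feasibleTest_le (lam : ℝ) (x y PX PY : ℕ → ℝ) (s t : ℕ) :
    (feasibleTest lam x y PX PY s t : Prog ℝ (ℕ → ℝ) Bool).steps ≤ 48 := by
  have h1 (a b : ℝ) := steps_lastNegative_le x lam s t a b
  have h2 (a b : ℝ) := steps_lastNegative_le y lam t s b a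
  have h3 : (productSmall lam s t : Prog ℝ (ℕ → ℝ) Bool).steps = 7 := by simp [productSmall]
  simp only [feasibleTest, Prog.steps_bind, h3]
  split_ifs
  · simp only [Prog.steps_bind, steps_readA, steps_tick, Prog.steps_pure, run_readA]
    have := h1 (PX s) (PY t)
    have := h2 (PX s) (PY t)
    omega
  · simp

/-- Each iteration decreases `(p + 1 - sv) + sw1`. -/
theorem steps_boundaryLoop_le (p : ℕ) (lam : ℝ) (x y PX PY : ℕ → ℝ) (sv sw1 : ℕ) (flag : Bool)
    (S : List (ℕ × ℕ)) :
    (boundaryLoop p lam x y PX PY sv sw1 flag S : Prog ℝ (ℕ → ℝ) _).steps ≤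
      52 * ((p + 1 - sv) + sw1) + 2 := by
  induction hn : (p + 1 - sv) + sw1 using Nat.strong_induction_on generalizing sv sw1 flag S with
  | _ n ih =>
    cases sw1 with
    | zero => simp [boundaryLoop]
    | succ sw =>
      rw [boundaryLoop]
      by_cases hp : p < sv
      · rw [dif_pos hp]
        simp
      · rw [dif_neg hp]
        simp only [Prog.steps_bind, steps_tick]
        have h1 := steps_feasibleTest_le lam x y PX PY sv sw
        by_cases hf : (feasibleTest lam x y PX PY sv sw : Prog ℝ (ℕ → ℝ) Bool).run = true
        · rw [if_pos hf]
          simp only [Prog.steps_bind, steps_tick]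
          have := ih _ (by omega) (sv + 1) (sw + 1) true S rfl
          omega
        · rw [if_neg hf]
          simp only [Prog.steps_bind, steps_tick]
          have := ih _ (by omega) sv sw false (if flag then (sv - 1, sw) :: S else S) rfl
          omega

/-- Each pair that is recorded uses up a decrement of `sw1` and an increment of `sv`; the set
flag stands for an increment that has not been used up. -/
theorem length_run_boundaryLoop_le (p : ℕ) (lam : ℝ) (x y PX PY : ℕ → ℝ) (sv sw1 : ℕ)
    (flag : Bool) (S : List (ℕ × ℕ)) (hfalse : flag = false → sv ≤ p) :
    (boundaryLoop p lam x y PX PY sv sw1 flag S : Prog ℝ (ℕ → ℝ) _).run.length ≤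
      S.length + min sw1 ((p + 1 - sv) + flag.toNat) := by
  induction hn : (p + 1 - sv) + sw1 using Nat.strong_induction_on generalizing sv sw1 flag S with
  | _ n ih =>
    cases sw1 with
    | zero => simp [boundaryLoop]
    | succ sw =>
      rw [boundaryLoop]
      by_cases hp : p < sv
      · rw [dif_pos hp]
        cases flag with
        | false => exact absurd (hfalse rfl) (by omega)
        | true =>
          simp only [Prog.run_bind, Prog.run_pure, List.length_cons, Bool.toNat_true]
          omega
      · rw [dif_neg hp]
        simp only [Prog.run_bind]
        by_cases hf : (feasibleTest lam x y PX PY sv sw : Prog ℝ (ℕ → ℝ) Bool).run = true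
        · rw [if_pos hf]
          simp only [Prog.run_bind]
          have := ih _ (by omega) (sv + 1) (sw + 1) true S (by simp) rfl
          rw [Bool.toNat_true] at this
          omega
        · rw [if_neg hf]
          simp only [Prog.run_bind]
          have := ih _ (by omega) sv sw false (if flag then (sv - 1, sw) :: S else S)
            (fun _ => not_lt.1 hp) rfl
          cases flag <;> simp at this ⊢ <;> omega

theorem steps_boundaryAlg_le (p m : ℕ) (lam : ℝ) (x y : ℕ → ℝ) :
    (boundaryAlg p m lam x y : Prog ℝ (ℕ → ℝ) _).steps ≤ 59 * (m + p) + 110 := by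
  simp only [boundaryAlg, Prog.steps_bind]
  have h1 := steps_cumSums_le x p
  have h2 := steps_cumSums_le y m
  have h3 := steps_boundaryLoop_le p lam x y (cumSums x p : Prog ℝ (ℕ → ℝ) _).run
    (cumSums y m : Prog ℝ (ℕ → ℝ) _).run 0 (m + 1) true []
  omega

theorem length_run_boundaryAlg_le (p m : ℕ) (lam : ℝ) (x y : ℕ → ℝ) :
    (boundaryAlg p m lam x y : Prog ℝ (ℕ → ℝ) _).run.length ≤ min m p + 2 := by
  simp only [boundaryAlg, Prog.run_bind]
  have h := length_run_boundaryLoop_le p lam x y (cumSums x p : Prog ℝ (ℕ → ℝ) _).run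
    (cumSums y m : Prog ℝ (ℕ → ℝ) _).run 0 (m + 1) true [] (by simp)
  simp only [List.length_nil, Bool.toNat_true] at h
  omega

theorem steps_loopBody_le {p m : ℕ} (lam : ℝ) (x y : ℕ → ℝ) {s : ℕ × ℕ} (h1 : s.1 ≤ p)
    (h2 : s.2 ≤ m) (st : LoopState ℝ (ℕ → ℝ)) :
    (loopBody p m lam x y s st).steps ≤ 20 * (m + p) + 50 := by
  have hc : (candidate p m lam x y s.1 s.2 : Prog ℝ (ℕ → ℝ) _).steps ≤ 10 * (m + p) + 30 := by
    simp only [candidate, Prog.steps_bind, steps_shift, run_absSum, run_shift, Prog.steps_pure]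
    have := steps_absSum_le x s.1
    have := steps_absSum_le y s.2
    have (c : ℝ) := steps_fillArr_le x p s.1 c
    have (c : ℝ) := steps_fillArr_le y m s.2 c
    grind
  have he (v w : ℕ → ℝ) : (evalObjective p m lam x y v w : Prog ℝ (ℕ → ℝ) ℝ).steps ≤
      10 * (m + p) + 10 := by
    simp only [evalObjective, Prog.steps_bind, steps_addR, steps_natR, steps_divR, steps_mulR]
    have := steps_sqDist_le v x p
    have := steps_sqDist_le w y m
    have := steps_arrSum_le v p
    have := steps_arrSum_le w m
    omega
  simp only [loopBody, Prog.steps_bind, steps_tick]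
  set c := (candidate p m lam x y s.1 s.2 : Prog ℝ (ℕ → ℝ) _).run
  have hec := he c.1 c.2
  set h := (evalObjective p m lam x y c.1 c.2 : Prog ℝ (ℕ → ℝ) ℝ).run
  obtain ⟨best, v, w, ev⟩ := st
  cases best with
  | none =>
    simp only [Prog.run_pure, if_true, Prog.steps_bind, steps_tick, Prog.steps_pure]
    omega
  | some b =>
    dsimp only
    split_ifs
    · simp only [steps_ltR, Prog.steps_bind, steps_tick, Prog.steps_pure]
      omega
    · simp only [steps_ltR, Prog.steps_pure]
      omega

theorem steps_proxProg_le {p m : ℕ} {lam : ℝ} {x : Fin p → ℝ} {y : Fin m → ℝ} (hlam : 0 < lam)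
    (hx : Antitone fun k => |x k|) (hy : Antitone fun j => |y j|) :
    (proxProg lam x y).steps ≤
      67 * (m + p) + 114 + (min m p + 2) * (20 * (m + p) + 51) := by
  have hS := mem_run_boundaryAlg hlam hx hy
  unfold boundaryProg at hS
  simp only [proxProg, proxAlg, Prog.steps_bind, Prog.steps_pure, steps_newArr, run_newArr]
  have h1 := steps_boundaryAlg_le p m lam (toArr x) (toArr y)
  have h2 := length_run_boundaryAlg_le p m lam (toArr x) (toArr y)
  set S := (boundaryAlg p m lam (toArr x) (toArr y) : Prog ℝ (ℕ → ℝ) _).run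
  have h3 := steps_forList_le S (⟨none, fun _ => 0, fun _ => 0, []⟩ : LoopState ℝ (ℕ → ℝ))
    (fun s st => loopBody p m lam (toArr x) (toArr y) s st) fun r hr =>
      steps_loopBody_le lam (toArr x) (toArr y) ((hS r).1 hr).1.1 ((hS r).1 hr).1.2.1
  have h4 := h3.trans (Nat.mul_le_mul_right (20 * (m + p) + 51) h2)
  set st := (forList S (⟨none, fun _ => 0, fun _ => 0, []⟩ : LoopState ℝ (ℕ → ℝ)) fun s st =>
    loopBody p m lam (toArr x) (toArr y) s st).run
  have h5 := steps_applySign_le (toArr x) st.v p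
  have h6 := steps_applySign_le (toArr y) st.w m
  omega

end Steps

end PathNorm

theorem theorem4 :
    -- the algorithm, applied row by row, returns a global minimizer
    (∀ (n p m : ℕ) (lam : ℝ) (X : Matrix (Fin n) (Fin p) ℝ) (Y : Matrix (Fin n) (Fin m) ℝ),
      0 < lam → (∀ i, Antitone fun k => |X i k|) → (∀ i, Antitone fun j => |Y i j|) →
        IsMinOn (PathNorm.proxObjective lam X Y) Set.univ (PathNorm.proxOutput lam X Y)) ∧
    -- the boundary algorithm computes the maximal feasibility boundary, exactly its pairs are
    -- evaluated, and the output is a best one of their candidates, with the signs restored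
    (∀ (p m : ℕ) (lam : ℝ) (x : Fin p → ℝ) (y : Fin m → ℝ),
      0 < lam → (Antitone fun k => |x k|) → (Antitone fun j => |y j|) →
        {s | s ∈ (PathNorm.boundaryProg lam x y).run} = PathNorm.MFB lam x y ∧
        {s | s ∈ (PathNorm.proxProg lam x y).run.evaluated} = PathNorm.MFB lam x y ∧
        ∃ s ∈ PathNorm.MFB lam x y,
          (PathNorm.ofArr p (PathNorm.proxProg lam x y).run.v =
            fun k => Real.sign (x k) * PathNorm.candV lam x y s.1 s.2 k) ∧
          (PathNorm.ofArr m (PathNorm.proxProg lam x y).run.w =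
            fun j => Real.sign (y j) * PathNorm.candW lam x y s.1 s.2 j) ∧
          ∀ t ∈ PathNorm.MFB lam x y,
            PathNorm.rowObjective lam x y (PathNorm.candV lam x y s.1 s.2)
                (PathNorm.candW lam x y s.1 s.2) ≤
              PathNorm.rowObjective lam x y (PathNorm.candV lam x y t.1 t.2)
                (PathNorm.candW lam x y t.1 t.2)) ∧
    -- the running times, for one row
    (∃ C : ℕ, ∀ (p m : ℕ) (lam : ℝ) (x : Fin p → ℝ) (y : Fin m → ℝ),
      1 ≤ p → 1 ≤ m → 0 < lam → (Antitone fun k => |x k|) → (Antitone fun j => |y j|) →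
        (PathNorm.boundaryProg lam x y).steps ≤ C * (m + p) ∧
        (PathNorm.proxProg lam x y).steps ≤ C * (min m p * (m + p))) := by
  refine ⟨fun n p m lam X Y hlam hX hY => ?_, fun p m lam x y hlam hx hy => ?_, 1000,
    fun p m lam x y hp hm hlam hx hy => ⟨?_, ?_⟩⟩
  · choose s hs hv hw hmin using fun i => (PathNorm.run_proxProg hlam (hX i) (hY i)).2
    have hout : PathNorm.proxOutput lam X Y =
        (Matrix.of fun i k => Real.sign (X i k) *
            PathNorm.candV lam (X i) (Y i) (s i).1 (s i).2 k,
          Matrix.of fun i j => Real.sign (Y i j) *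
            PathNorm.candW lam (X i) (Y i) (s i).1 (s i).2 j) := by
      unfold PathNorm.proxOutput
      simp only [hv, hw]
    rw [hout]
    exact fun U _ => PathNorm.proxObjective_sign_le hlam X Y _ _
      (fun i => (hs i).1.candV_nonneg (hX i)) (fun i => (hs i).1.candW_nonneg (hY i))
      (fun i _ _ => PathNorm.rowObjective_le_of_MFB_min hlam (hX i) (hY i) (hmin i)) U
  · obtain ⟨hev, hbest⟩ := PathNorm.run_proxProg hlam hx hy
    exact ⟨Set.ext (PathNorm.mem_run_boundaryAlg hlam hx hy), Set.ext hev, hbest⟩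
  · have := PathNorm.steps_boundaryAlg_le p m lam (PathNorm.toArr x) (PathNorm.toArr y)
    unfold PathNorm.boundaryProg
    omega
  · refine (PathNorm.steps_proxProg_le hlam hx hy).trans ?_
    have h1 : 1 ≤ min m p := le_min hm hp
    have h2 : m + p ≤ min m p * (m + p) := Nat.le_mul_of_pos_left _ h1
    have h3 : min m p ≤ min m p * (m + p) := Nat.le_mul_of_pos_right _ (by omega)
    have h4 : (min m p + 2) * (20 * (m + p) + 51) =
        20 * (min m p * (m + p)) + 51 * min m p + 40 * (m + p) + 102 := by ring
    omega
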